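/- Let $1\le M\le N$ be integers, $a=(a_1,\dots,a_M)$ with all $a_j>0$, $b_0>0$, and $b_1,\dots,b_N>0$. For a tuple $c=(c_1,\dots,c_n)$ of positive reals ($n\ge 0$) and $\Re(w)>0$ let $$\zeta_n(s,w\,|\,c)=\frac1{\Gamma(s)}\int_0^\infty t^{s-1}e^{-wt}\prod_{j=1}^n(1-e^{-c_jt})^{-1}\,dt,\qquad \Re(s)>n,$$ continued analytically in $s$ to $\mathbb C\setminus\{1,\dots,n\}$, and let $L_n(w\,|\,c)=\partial_s\zeta_n(s,w\,|\,c)|_{s=0}$ and $\Gamma_n(w\,|\,c)=\exp L_n(w\,|\,c)$ (the Barnes multiple gamma function; $\Gamma_0(w)=1/w$). For a function $f$ put $$(\mathcal S_Nf)(q\,|\,b)=\sum_{p=0}^N(-1)^p\sum_{1\le j_1<\dots<j_p\le N}f(q+b_0+b_{j_1}+\dots+b_{j_p}),$$ and let $\eta_{M,N}(q\,|\,a,b)=\exp\bigl((\mathcal S_NL_M(\cdot\,|\,a))(q\,|\,b)-(\mathcal S_NL_M(\cdot\,|\,a))(0\,|\,b)\bigr)$ for $\Re(q)>-b_0$. Then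 there is a unique probability distribution on $(0,1]$, the Barnes beta distribution, such that a random variable $\beta_{M,N}(a,b)$ with this distribution satisfies $\mathbf E[\beta_{M,N}(a,b)^q]=\eta_{M,N}(q\,|\,a,b)$ for all $q\in\mathbb C$ with $\Re(q)>-b_0$. Its moments are as follows. Let $1\le i\le M$ and let $\hat a_i$ be the tuple $a$ with $a_i$ deleted. For every integer $k\ge 0$ the moment $\mathbf E[\beta_{M,N}(a,b)^{ka_i}]$ is finite and $$\mathbf E\bigl[\beta_{M,N}(a,b)^{ka_i}\bigr]=\exp\Bigl(-\sum_{l=0}^{k-1}\bigl(\mathcal S_NL_{M-1}(\cdot\,|\,\hat a_i)\bigr)(la_i\,|\,b)\Bigr)=\prod_{l=0}^{k-1}\prod_{p=0}^N\Bigl[\prod_{j_1<\dots<j_p}\Gamma_{M-1}\bigl(la_i+b_0+b_{j_1}+\dots+b_{j_p}\,|\,\hat a_i\bigr)\Bigr]^{(-1)^{p+1}}.$$ For every integer $k\ge 0$ with $ka_i<b_0$ the moment $\mathbf E[\beta_{M,N}(a,b)^{-ka_i}]$ is finite and $$\mathbf E\bigl[\beta_{M,N}(a,b)^{-ka_i}\bigr]=\exp\Bigl(\sum_{l=0}^{k-1}\bigl(\mathcal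 S_NL_{M-1}(\cdot\,|\,\hat a_i)\bigr)(-(l+1)a_i\,|\,b)\Bigr)=\prod_{l=0}^{k-1}\prod_{p=0}^N\Bigl[\prod_{j_1<\dots<j_p}\Gamma_{M-1}\bigl(-(l+1)a_i+b_0+b_{j_1}+\dots+b_{j_p}\,|\,\hat a_i\bigr)\Bigr]^{(-1)^p}.$$ -/

import Mathlib

noncomputable section

/-- The function `f(t) = t ^ M * ∏ j, (1 - exp (-a_j t))⁻¹`, used for `t > 0`. -/
def barnesF {M : ℕ} (a : Fin M → ℝ) (t : ℝ) : ℝ :=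
  t ^ M * ∏ j, (1 - Real.exp (-(a j * t)))⁻¹

/-- `Z` is the analytic continuation in `s` to `ℂ \ {1, …, M}` of the multiple zeta function
`ζ_M(s, w | a) = Γ(s)⁻¹ ∫₀^∞ t^(s-1) e^(-w t) f(t) dt / t^M`, `Re s > M` (for a given `w` with
`Re w > 0`). As `ℂ \ {1, …, M}` is connected, `Z` is determined there by these conditions. -/
def IsBarnesZeta {M : ℕ} (a : Fin M → ℝ) (w : ℂ) (Z : ℂ → ℂ) : Prop :=
  DifferentiableOn ℂ Z {s : ℂ | ∀ m : ℕ, m ∈ Finset.Icc 1 M → s ≠ (m : ℂ)} ∧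
  ∀ s : ℂ, (M : ℝ) < s.re →
    Z s = 1 / Complex.Gamma s *
      ∫ t in Set.Ioi (0 : ℝ),
        (t : ℂ) ^ (s - 1) * Complex.exp (-(w * t)) * ((barnesF a t / t ^ M : ℝ) : ℂ)

open Classical in
/-- The multiple zeta function `s ↦ ζ_M(s, w | a)`, `Re w > 0`, continued analytically in `s`
to `ℂ \ {1, …, M}`. -/
def barnesZeta {M : ℕ} (a : Fin M → ℝ) (w : ℂ) : ℂ → ℂ :=
  if h : ∃ Z : ℂ → ℂ, IsBarnesZeta a w Z then h.choose else 0

/-- The multiple log-gamma function `L_M(w | a) = ∂_s ζ_M(s, w | a)` at `s = 0`, `Re w > 0`. -/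
def barnesLogGamma {M : ℕ} (a : Fin M → ℝ) (w : ℂ) : ℂ :=
  deriv (barnesZeta a w) 0

/-- The Barnes multiple gamma function `Γ_M(w | a) = exp (L_M(w | a))`, `Re w > 0`. -/
def barnesGamma {M : ℕ} (a : Fin M → ℝ) (w : ℂ) : ℂ :=
  Complex.exp (barnesLogGamma a w)

/-- The operator `(S_N f)(q | b) = ∑_p (-1)^p ∑_{k₁ < ⋯ < k_p} f (q + b₀ + b_{k₁} + ⋯ + b_{k_p})`,
where `{k₁ < ⋯ < k_p}` runs over the `p`-element sets of indices. -/
def barnesS {N : ℕ} (f : ℂ → ℂ) (q : ℂ) (b₀ : ℝ) (b : Fin N → ℝ) : ℂ :=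
  ∑ p ∈ Finset.range (N + 1), (-1 : ℂ) ^ p *
    ∑ J ∈ Finset.powersetCard p (Finset.univ : Finset (Fin N)),
      f (q + b₀ + ∑ j ∈ J, (b j : ℂ))

/-- `η_{M,N}(q | a, b) = exp ((S_N L_M)(q | b) - (S_N L_M)(0 | b))`, used for `Re q > -b₀`. -/
def barnesEta {M N : ℕ} (a : Fin M → ℝ) (b₀ : ℝ) (b : Fin N → ℝ) (q : ℂ) : ℂ :=
  Complex.exp (barnesS (barnesLogGamma a) q b₀ b - barnesS (barnesLogGamma a) 0 b₀ b)

/-- `μ` is the Barnes beta distribution `β_{M,N}(a, b)`: the probability distribution on `(0, 1]`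
whose Mellin transform is `η_{M,N}(q | a, b)` for `Re q > -b₀`. -/
structure IsBarnesBeta {M N : ℕ} (a : Fin M → ℝ) (b₀ : ℝ) (b : Fin N → ℝ)
    (μ : MeasureTheory.Measure ℝ) : Prop where
  isProbabilityMeasure : MeasureTheory.IsProbabilityMeasure μ
  ae_mem : ∀ᵐ x ∂μ, x ∈ Set.Ioc (0 : ℝ) 1
  integrable : ∀ q : ℂ, -b₀ < q.re → MeasureTheory.Integrable (fun x : ℝ => (x : ℂ) ^ q) μ
  mellin : ∀ q : ℂ, -b₀ < q.re → ∫ x : ℝ, (x : ℂ) ^ q ∂μ = barnesEta a b₀ b q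

end

/-! The alternating sum over subsets in `barnesS` expands ∏ (1 - e^(-b_j t)). Hence, with F = ∏ (1 -
e^(-b_j t)) / ∏ (1 - e^(-a_j t)), the difference S_N L_M(q) - S_N L_M(q') is the integral over t > 0
of (e^(-(q+b₀)t) - e^(-(q'+b₀)t)) F(t) / t (`barnesS_barnesLogGamma_sub`). This rests on
`sum_mul_barnesLogGamma`: a combination of multiple zeta functions is the Mellin transform of its
generating function G divided by Γ(s). If G = O(t) at 0, the transform is holomorphic at s = 0,
where 1/Γ(s) has a simple zero with derivative 1, so the s-derivative there is ∫ G(t)/t dt. The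
continuation itself comes from integration by parts (`exists_entire_mellin_div_Gamma`,
`exists_isBarnesZeta`).

For q' = 0 the formula is a Lévy-Khintchine exponent with positive Lévy density e^(-b₀ t) F(t) / t.
Since F = O(t^(N-M)) at 0, this density is integrable when M < N and gives a compound Poisson law.
When M = N it behaves like K/t at 0; a gamma law carries this singularity, and what is left is a
finite positive measure (`exists_levy_bounds`, `exists_measure_laplace_levy`). If X ≥ 0 has the
resulting law, β = e^(-X). Uniqueness holds because the Mellin transform on the imaginary axis is
the characteristic function of log β.

For the moments, shifting q by a_i multiplies e^(-(q+b₀)t) by e^(-a_i t), and the factor e^(-a_i t)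
- 1 cancels the i-th denominator of F. So the shift changes S_N L_M by -S_N L_(M-1) with a_i deleted
(`barnesS_barnesLogGamma_add`), and k shifts telescope. -/

open Set Filter Topology MeasureTheory

/-! ### Mellin transforms divided by Γ -/

/-- One integration by parts step for the Mellin transform. -/
theorem mellin_deriv_add_one {f f' : ℝ → ℂ} {ρ : ℝ} (hρ : 0 < ρ)
    (hf : ∀ t ∈ Ioi (0 : ℝ), HasDerivAt f (f' t) t)
    (hf' : ContinuousOn f' (Ioi 0))
    (h0 : f =O[𝓝[>] 0] (fun _ => (1 : ℝ))) (h0' : f' =O[𝓝[>] 0] (fun _ => (1 : ℝ)))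
    (htop : f =O[atTop] fun t => Real.exp (-ρ * t))
    (htop' : f' =O[atTop] fun t => Real.exp (-ρ * t)) {z : ℂ} (hz : 0 < z.re) :
    mellin f' (z + 1) = -z * mellin f z := by
  have hfc : ContinuousOn f (Ioi 0) := fun t ht => (hf t ht).continuousAt.continuousWithinAt
  have h0r : f =O[𝓝[>] 0] (fun t : ℝ => t ^ (-(0 : ℝ))) := by simpa using h0
  have h0r' : f' =O[𝓝[>] 0] (fun t : ℝ => t ^ (-(0 : ℝ))) := by simpa using h0'
  have hc := mellinConvergent_of_isBigO_rpow_exp hρ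
    (hfc.locallyIntegrableOn measurableSet_Ioi) htop h0r hz
  have hc' := mellinConvergent_of_isBigO_rpow_exp (s := z + 1) hρ
    (hf'.locallyIntegrableOn measurableSet_Ioi) htop' h0r' (by simpa using by linarith)
  have hz0 : z ≠ 0 := fun h => by simp [h] at hz
  have key := integral_Ioi_mul_deriv_eq_deriv_mul (a := 0) (a' := (0 : ℂ)) (b' := 0)
    (u := fun t : ℝ => (t : ℂ) ^ z) (u' := fun t : ℝ => z * (t : ℂ) ^ (z - 1)) (v := f) (v' := f')
    (fun t ht => by
      have := (hasDerivAt_id (t : ℂ)).cpow_const (c := z) (Or.inl (by simpa using ht))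
      simpa using this.comp_ofReal)
    hf
    (by simpa [MellinConvergent, Pi.mul_def] using hc')
    (by
      have := hc.const_mul z
      simpa [MellinConvergent, IntegrableOn, Pi.mul_def, mul_assoc] using this)
    (by
      have h1 : Tendsto (fun t : ℝ => t ^ z.re) (𝓝[>] 0) (𝓝 0) := by
        have := (Real.continuousAt_rpow_const 0 z.re (Or.inr hz.le)).tendsto
        rw [Real.zero_rpow hz.ne'] at this
        exact this.mono_left nhdsWithin_le_nhds
      have h2 : (fun t : ℝ => (t : ℂ) ^ z) =O[𝓝[>] 0] (fun t : ℝ => t ^ z.re) := by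
        refine Asymptotics.IsBigO.of_bound 1 ?_
        filter_upwards [self_mem_nhdsWithin] with t ht
        rw [Complex.norm_cpow_eq_rpow_re_of_pos ht, one_mul]
        exact le_abs_self _
      have h3 := h2.mul h0
      refine h3.trans_tendsto ?_
      simpa using h1)
    (by
      have h2 : (fun t : ℝ => (t : ℂ) ^ z) =O[atTop] (fun t : ℝ => t ^ z.re) := by
        refine Asymptotics.IsBigO.of_bound 1 ?_
        filter_upwards [eventually_gt_atTop 0] with t ht
        rw [Complex.norm_cpow_eq_rpow_re_of_pos ht, one_mul]
        exact le_abs_self _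
      refine (h2.mul htop).trans_tendsto ?_
      simpa using! tendsto_rpow_mul_exp_neg_mul_atTop_nhds_zero z.re ρ hρ)
  have e1 : mellin f' (z + 1) = ∫ t in Ioi (0 : ℝ), (t : ℂ) ^ z * f' t := by
    simp [mellin]
  rw [e1, key, mellin]
  simp only [mul_assoc, sub_zero, zero_sub, smul_eq_mul]
  rw [integral_const_mul]
  ring

/-- If `h` is holomorphic near `[0, ∞)` and all its derivatives decay exponentially, then
`s ↦ Γ(s)⁻¹ ∫₀^∞ t^(s-1) h(t) dt` extends to an entire function. -/
theorem exists_entire_mellin_div_Gamma {h : ℂ → ℂ} {U : Set ℂ} (hU : IsOpen U)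
    (hmem : ∀ t : ℝ, 0 ≤ t → (t : ℂ) ∈ U) (hd : DifferentiableOn ℂ h U) {ρ : ℝ} (hρ : 0 < ρ)
    (hdecay : ∀ k, (fun t : ℝ => iteratedDeriv k h t) =O[atTop] fun t => Real.exp (-ρ * t)) :
    ∃ J : ℂ → ℂ, Differentiable ℂ J ∧
      ∀ s : ℂ, 0 < s.re → J s = mellin (fun t : ℝ => h t) s / Complex.Gamma s := by
  have hdk : ∀ k, DifferentiableOn ℂ (iteratedDeriv k h) U := by
    intro k
    induction k with
    | zero => simpa using hd
    | succ k ih =>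
      rw [iteratedDeriv_succ]
      exact ih.deriv hU
  have hcont : ∀ k, ContinuousOn (fun t : ℝ => iteratedDeriv k h t) (Ici 0) := fun k =>
    (hdk k).continuousOn.comp Complex.continuous_ofReal.continuousOn fun t ht => hmem t ht
  have hzero : ∀ k, (fun t : ℝ => iteratedDeriv k h t) =O[𝓝[>] 0] (fun _ => (1 : ℝ)) := by
    intro k
    have : Tendsto (fun t : ℝ => iteratedDeriv k h t) (𝓝[>] 0)
        (𝓝 (iteratedDeriv k h ((0 : ℝ) : ℂ))) :=
      ((hcont k) 0 self_mem_Ici).mono_left (nhdsWithin_mono _ Ioi_subset_Ici_self)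
    exact this.isBigO_one ℝ
  have hzero' : ∀ k, (fun t : ℝ => iteratedDeriv k h t) =O[𝓝[>] 0]
      (fun t : ℝ => t ^ (-(0 : ℝ))) := by
    intro k; simpa using hzero k
  have hderiv : ∀ k, ∀ t ∈ Ioi (0 : ℝ),
      HasDerivAt (fun t : ℝ => iteratedDeriv k h t) (iteratedDeriv (k + 1) h t) t := by
    intro k t ht
    have := ((hdk k).differentiableAt (hU.mem_nhds (hmem t (le_of_lt ht)))).hasDerivAt
    rw [← iteratedDeriv_succ] at this
    exact this.comp_ofReal
  -- The result of k integrations by parts: the factors -(s + j) they produce cancel against Γ(s +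
  -- k), up to sign. The k-th expression is holomorphic for Re s > -k.
  let Jk : ℕ → ℂ → ℂ := fun k s =>
    (-1) ^ k * (mellin (fun t : ℝ => iteratedDeriv k h t) (s + k) * (Complex.Gamma (s + k))⁻¹)
  have hJd : ∀ (k : ℕ) (s : ℂ), -(k : ℝ) < s.re → DifferentiableAt ℂ (Jk k) s := by
    intro k s hs
    have h1 : DifferentiableAt ℂ (mellin (fun t : ℝ => iteratedDeriv k h t)) (s + k) :=
      mellin_differentiableAt_of_isBigO_rpow_exp hρ
        (((hcont k).mono Ioi_subset_Ici_self).locallyIntegrableOn measurableSet_Ioi)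
        (hdecay k) (hzero' k) (by simp; linarith)
    have h3 : DifferentiableAt ℂ (fun s : ℂ => s + k) s := by fun_prop
    have h2 := (Complex.differentiable_one_div_Gamma (s + k)).comp s h3
    have h4 := DifferentiableAt.comp s h1 h3
    exact (h4.mul h2).const_mul _
  have hJs : ∀ (k : ℕ) (s : ℂ), -(k : ℝ) < s.re → Jk (k + 1) s = Jk k s := by
    intro k s hs
    have hs' : 0 < (s + k).re := by simp; linarith
    have := mellin_deriv_add_one hρ (hderiv k) ((hcont (k + 1)).mono Ioi_subset_Ici_self)
      (hzero k) (hzero (k + 1)) (hdecay k) (hdecay (k + 1)) hs'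
    have hne : s + k ≠ 0 := fun h => by simp [h] at hs'
    simp only [Jk, Nat.cast_add, Nat.cast_one]
    rw [← add_assoc, this, Complex.Gamma_add_one _ hne, mul_inv]
    field_simp
    ring
  have hJle : ∀ (k l : ℕ) (s : ℂ), k ≤ l → -(k : ℝ) < s.re → Jk l s = Jk k s := by
    intro k l s hkl hs
    induction l, hkl using Nat.le_induction with
    | base => rfl
    | succ l hl ih =>
      rw [hJs l s (by have : (k : ℝ) ≤ l := by exact_mod_cast hl
                      linarith), ih]
  -- Any k with -k < Re s would do. The expressions agree where they overlap, so choosing k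
  -- pointwise still gives a holomorphic function.
  let κ : ℂ → ℕ := fun s => ⌊-s.re⌋₊ + 1
  have hκ : ∀ s, -(κ s : ℝ) < s.re := fun s => by
    have := Nat.lt_floor_add_one (-s.re)
    simp only [κ]; push_cast; linarith
  have hJeq : ∀ (k : ℕ) (s : ℂ), -(k : ℝ) < s.re → Jk (κ s) s = Jk k s := by
    intro k s hs
    rcases le_total k (κ s) with hk | hk
    · exact hJle _ _ s hk hs
    · exact (hJle _ _ s hk (hκ s)).symm
  refine ⟨fun s => Jk (κ s) s, fun s => ?_, fun s hs => ?_⟩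
  · refine (hJd (κ s) s (hκ s)).congr_of_eventuallyEq ?_
    have : {z : ℂ | -(κ s : ℝ) < z.re} ∈ 𝓝 s :=
      (isOpen_lt continuous_const Complex.continuous_re).mem_nhds (hκ s)
    filter_upwards [this] with z hz using hJeq _ z hz
  · beta_reduce
    rw [hJeq 0 s (by simpa using hs)]
    simp [Jk, div_eq_mul_inv]

/-! ### Analytic continuation of the multiple zeta function -/

/-- The entire function `z ↦ (1 - exp (-c z)) / z`. -/
noncomputable def expQuot (c : ℝ) : ℂ → ℂ :=
  dslope (fun z : ℂ => 1 - Complex.exp (-(c * z))) 0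

theorem differentiable_expQuot (c : ℝ) : Differentiable ℂ (expQuot c) := by
  have : DifferentiableOn ℂ (fun z : ℂ => 1 - Complex.exp (-(c * z))) univ := by fun_prop
  exact differentiableOn_univ.1 ((Complex.differentiableOn_dslope univ_mem).2 this)

theorem expQuot_zero (c : ℝ) : expQuot c 0 = c := by
  rw [expQuot, dslope_same]
  have h1 : HasDerivAt (fun z : ℂ => -(c * z)) (-(c * 1)) 0 :=
    ((hasDerivAt_id (0 : ℂ)).const_mul (c : ℂ)).neg
  have := (h1.cexp.const_sub 1).deriv
  simpa using this

theorem expQuot_of_ne {c : ℝ} {z : ℂ} (hz : z ≠ 0) :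
    expQuot c z = (1 - Complex.exp (-(c * z))) / z := by
  rw [expQuot, dslope_of_ne _ hz, slope_def_field]
  simp

theorem one_sub_exp_le_norm_one_sub_cexp {c r : ℝ} (hc : 0 < c) {z : ℂ} (hz : r ≤ z.re) :
    1 - Real.exp (-(c * r)) ≤ ‖1 - Complex.exp (-(c * z))‖ := by
  have h1 : ‖Complex.exp (-(c * z))‖ ≤ Real.exp (-(c * r)) := by
    rw [Complex.norm_exp]
    gcongr
    simpa using! mul_le_mul_of_nonneg_left hz hc.le
  have h2 := norm_sub_norm_le (1 : ℂ) (Complex.exp (-(c * z)))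
  rw [norm_one] at h2
  linarith

theorem one_sub_exp_neg_pos {c t : ℝ} (hc : 0 < c) (ht : 0 < t) :
    0 < 1 - Real.exp (-(c * t)) := by
  have := mul_pos hc ht
  exact sub_pos.2 (Real.exp_lt_one_iff.2 (by linarith))

theorem expQuot_ne_zero_of_re_pos {c : ℝ} (hc : 0 < c) {z : ℂ} (hz : 0 < z.re) :
    expQuot c z ≠ 0 := by
  have hz0 : z ≠ 0 := fun h => by simp [h] at hz
  rw [expQuot_of_ne hz0]
  refine div_ne_zero (norm_pos_iff.1 ?_) hz0
  exact (one_sub_exp_neg_pos hc hz).trans_le (one_sub_exp_le_norm_one_sub_cexp hc le_rfl)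

/-- The regularised integrand `exp (-w z) ∏ j, z / (1 - exp (-a_j z))` of the multiple zeta
function. -/
noncomputable def barnesKernel {M : ℕ} (a : Fin M → ℝ) (w z : ℂ) : ℂ :=
  Complex.exp (-(w * z)) * (∏ j, expQuot (a j) z)⁻¹

theorem differentiableOn_barnesKernel {M : ℕ} (a : Fin M → ℝ) (w : ℂ) :
    DifferentiableOn ℂ (barnesKernel a w) {z | ∏ j, expQuot (a j) z ≠ 0} := by
  have h1 : Differentiable ℂ fun z => ∏ j, expQuot (a j) z :=
    Differentiable.fun_finsetProd fun j _ => differentiable_expQuot (a j)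
  have h2 : Differentiable ℂ fun z => Complex.exp (-(w * z)) := by fun_prop
  exact h2.differentiableOn.mul (h1.differentiableOn.inv fun z hz => hz)

theorem prod_expQuot_ne_zero {M : ℕ} {a : Fin M → ℝ} (ha : ∀ j, 0 < a j) {z : ℂ}
    (hz : 0 < z.re) : ∏ j, expQuot (a j) z ≠ 0 :=
  Finset.prod_ne_zero_iff.2 fun j _ => expQuot_ne_zero_of_re_pos (ha j) hz

/-- Input for Cauchy's estimate on the disc of radius 1/2 about t ≥ 1. There Re z ≥ 1/2 keeps the
denominators away from 0, and |z| ≤ t + 1/2 ≤ 2t. -/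
theorem norm_barnesKernel_le {M : ℕ} {a : Fin M → ℝ} (ha : ∀ j, 0 < a j) (w : ℂ) {t : ℝ}
    (ht : 1 ≤ t) {z : ℂ} (hz : ‖z - t‖ ≤ 1 / 2) :
    ‖barnesKernel a w z‖ ≤ Real.exp (‖w‖ / 2) * Real.exp (-(w.re * t)) *
      ((2 * t) ^ M * (∏ j, (1 - Real.exp (-(a j * (1 / 2))))⁻¹)) := by
  have hre : 1 / 2 ≤ z.re := by
    have h1 := (Complex.abs_re_le_norm (z - t)).trans hz
    simp only [Complex.sub_re, Complex.ofReal_re] at h1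
    linarith [(abs_le.1 h1).1]
  have hz0 : z ≠ 0 := fun h => by simp [h] at hre; linarith
  rw [barnesKernel, norm_mul]
  gcongr
  · rw [Complex.norm_exp, ← Real.exp_add]
    gcongr
    have h1 : -(w * z) = -(w * t) - w * (z - t) := by ring
    have h2 := (Complex.abs_re_le_norm (w * (z - t)))
    rw [norm_mul] at h2
    have h3 : ‖w‖ * ‖z - t‖ ≤ ‖w‖ * (1 / 2) := by gcongr
    rw [h1]
    have h4 := (abs_le.1 (h2.trans h3)).1
    simp only [Complex.sub_re, Complex.neg_re, Complex.re_mul_ofReal]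
    linarith
  · rw [norm_inv, norm_prod, ← Finset.prod_inv_distrib]
    have : (2 * t) ^ M * (∏ j, (1 - Real.exp (-(a j * (1 / 2))))⁻¹) =
        ∏ j, (2 * t * (1 - Real.exp (-(a j * (1 / 2))))⁻¹) := by
      rw [Finset.prod_mul_distrib]; simp
    rw [this]
    refine Finset.prod_le_prod (fun j _ => by positivity) fun j _ => ?_
    rw [expQuot_of_ne hz0, norm_div, inv_div, div_eq_mul_inv]
    have h1 := one_sub_exp_neg_pos (ha j) (by norm_num : (0 : ℝ) < 1 / 2)
    gcongr
    · have h2 : ‖z‖ ≤ ‖z - t‖ + ‖(t : ℂ)‖ := by simpa using norm_add_le (z - t) t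
      rw [Complex.norm_real, Real.norm_of_nonneg (by linarith)] at h2
      linarith
    · exact one_sub_exp_le_norm_one_sub_cexp (ha j) hre

/-- Cauchy's estimate bounds every derivative by t^M e^(-Re(w) t); half of the exponential rate is
given up to absorb t^M. -/
theorem iteratedDeriv_barnesKernel_isBigO {M : ℕ} {a : Fin M → ℝ} (ha : ∀ j, 0 < a j) {w : ℂ}
    (hw : 0 < w.re) (k : ℕ) :
    (fun t : ℝ => iteratedDeriv k (barnesKernel a w) t) =O[atTop]
      fun t => Real.exp (-(w.re / 2) * t) := by
  set A : ℝ := ∏ j, (1 - Real.exp (-(a j * (1 / 2))))⁻¹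
  have h1 : (fun t : ℝ => iteratedDeriv k (barnesKernel a w) t) =O[atTop]
      fun t : ℝ => t ^ M * Real.exp (-(w.re * t)) := by
    refine Asymptotics.IsBigO.of_bound
      (k.factorial * (Real.exp (‖w‖ / 2) * 2 ^ M * A) / (1 / 2) ^ k) ?_
    filter_upwards [eventually_ge_atTop 1] with t ht
    have h := Complex.norm_iteratedDeriv_le_of_forall_mem_sphere_norm_le (c := (t : ℂ))
      (R := 1 / 2) (f := barnesKernel a w) (C := Real.exp (‖w‖ / 2) * Real.exp (-(w.re * t)) *
      ((2 * t) ^ M * A)) k (by norm_num) ?_ ?_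
    · refine h.trans (le_of_eq ?_)
      rw [norm_mul, norm_pow, Real.norm_of_nonneg (by linarith : (0 : ℝ) ≤ t),
        Real.norm_of_nonneg (Real.exp_pos _).le]
      ring
    · refine DifferentiableOn.diffContOnCl ?_
      rw [closure_ball _ (by norm_num)]
      refine (differentiableOn_barnesKernel a w).mono fun z hz => ?_
      refine prod_expQuot_ne_zero ha ?_
      rw [Metric.mem_closedBall, dist_eq_norm] at hz
      have h1 := (Complex.abs_re_le_norm (z - t)).trans hz
      simp only [Complex.sub_re, Complex.ofReal_re] at h1
      linarith [(abs_le.1 h1).1]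
    · intro z hz
      rw [mem_sphere_iff_norm] at hz
      exact norm_barnesKernel_le ha w ht hz.le
  have h2 : (fun t : ℝ => t ^ M) =O[atTop] fun t => Real.exp (w.re / 2 * t) :=
    (isLittleO_pow_exp_pos_mul_atTop M (half_pos hw)).isBigO
  refine h1.trans ((h2.mul (Asymptotics.isBigO_refl
    (fun t : ℝ => Real.exp (-(w.re * t))) atTop)).congr_right fun t => ?_)
  rw [← Real.exp_add]
  ring_nf

theorem ofReal_prod_inv_eq {M : ℕ} (a : Fin M → ℝ) {t : ℝ} (ht : 0 < t) :
    ((barnesF a t / t ^ M : ℝ) : ℂ) = (∏ j, (1 - Complex.exp (-(a j * t)))⁻¹) := by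
  rw [barnesF, mul_div_cancel_left₀ _ (by positivity)]
  push_cast
  rfl

theorem Complex.Gamma_eq_prod_mul_Gamma_sub (n : ℕ) {s : ℂ} (hs : (n : ℝ) < s.re) :
    Complex.Gamma s = (∏ m ∈ Finset.Icc 1 n, (s - m)) * Complex.Gamma (s - n) := by
  induction n with
  | zero => simp
  | succ n ih =>
    push_cast at hs
    rw [ih (by linarith), Finset.prod_Icc_succ_top (by omega), mul_assoc]
    congr 1
    have : s - n = (s - (n + 1 : ℕ)) + 1 := by push_cast; ring
    rw [this, Complex.Gamma_add_one]
    intro h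
    have := congrArg Complex.re h
    simp at this
    linarith

theorem cpow_mul_prod_inv_eq_barnesKernel {M : ℕ} (a : Fin M → ℝ) (w s : ℂ) {t : ℝ}
    (ht : 0 < t) :
    (t : ℂ) ^ (s - 1) * (Complex.exp (-(w * t)) * ∏ j, (1 - Complex.exp (-(a j * t)))⁻¹) =
      (t : ℂ) ^ (s - M - 1) * barnesKernel a w t := by
  have ht0 : (t : ℂ) ≠ 0 := by exact_mod_cast ht.ne'
  rw [barnesKernel, ← Finset.prod_inv_distrib]
  simp only [expQuot_of_ne ht0, div_eq_mul_inv, mul_inv, inv_inv]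
  rw [Finset.prod_mul_distrib, show s - 1 = (s - M - 1) + (M : ℕ) by ring,
    Complex.cpow_add _ _ ht0, Complex.cpow_natCast]
  simp
  ring

/-- Writing the integrand with the regularised kernel costs a factor t^(-M), which moves the Mellin
variable to s - M. As Γ(s) = ∏ (s - m) · Γ(s - M) with m = 1, …, M, the zeta function is an entire
function divided by that product. This ensures that `barnesZeta` is not its default value 0. -/
theorem exists_isBarnesZeta {M : ℕ} {a : Fin M → ℝ} (ha : ∀ j, 0 < a j) {w : ℂ}
    (hw : 0 < w.re) : ∃ Z, IsBarnesZeta a w Z := by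
  have hprod : Differentiable ℂ fun z => ∏ j, expQuot (a j) z :=
    Differentiable.fun_finsetProd fun j _ => differentiable_expQuot (a j)
  obtain ⟨J, hJ, hJs⟩ := exists_entire_mellin_div_Gamma (h := barnesKernel a w)
    (U := {z | ∏ j, expQuot (a j) z ≠ 0}) (isOpen_ne_fun hprod.continuous continuous_const)
    (fun t ht => by
      rcases ht.eq_or_lt with rfl | ht
      · simp only [mem_ofPred_eq, Complex.ofReal_zero, expQuot_zero]
        exact Finset.prod_ne_zero_iff.2 fun j _ => by exact_mod_cast (ha j).ne'
      · exact prod_expQuot_ne_zero ha (by simpa using ht))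
    (differentiableOn_barnesKernel a w) (half_pos hw) (iteratedDeriv_barnesKernel_isBigO ha hw)
  refine ⟨fun s => J (s - M) / ∏ m ∈ Finset.Icc 1 M, (s - m), fun s hs => ?_, fun s hs => ?_⟩
  · refine DifferentiableAt.differentiableWithinAt (DifferentiableAt.div ?_ ?_ ?_)
    · exact (hJ (s - M)).comp s (by fun_prop)
    · fun_prop
    · exact Finset.prod_ne_zero_iff.2 fun m hm => sub_ne_zero.2 (hs m hm)
  · have hre : 0 < (s - M).re := by simpa using hs
    beta_reduce
    rw [hJs _ hre, Complex.Gamma_eq_prod_mul_Gamma_sub M hs]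
    have : ∫ t in Ioi (0 : ℝ), (t : ℂ) ^ (s - 1) * Complex.exp (-(w * t)) *
        ((barnesF a t / t ^ M : ℝ) : ℂ) = mellin (fun t : ℝ => barnesKernel a w t) (s - M) := by
      rw [mellin]
      refine setIntegral_congr_fun measurableSet_Ioi fun t ht => ?_
      rw [ofReal_prod_inv_eq a ht, mul_assoc, cpow_mul_prod_inv_eq_barnesKernel a w s ht,
        smul_eq_mul]
    rw [this, one_div, mul_inv]
    ring

theorem isBarnesZeta_barnesZeta {M : ℕ} {a : Fin M → ℝ} (ha : ∀ j, 0 < a j) {w : ℂ}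
    (hw : 0 < w.re) : IsBarnesZeta a w (barnesZeta a w) := by
  have h := exists_isBarnesZeta ha hw
  rw [barnesZeta, dif_pos h]
  exact h.choose_spec

/-! ### Log-gamma combinations as integrals -/

theorem mellinConvergent_exp_mul_prod_inv {M : ℕ} {a : Fin M → ℝ} (ha : ∀ j, 0 < a j) {w : ℂ}
    (hw : 0 < w.re) {s : ℂ} (hs : (M : ℝ) < s.re) :
    MellinConvergent
      (fun t : ℝ => Complex.exp (-(w * t)) * ∏ j, (1 - Complex.exp (-(a j * t)))⁻¹) s := by
  have hU : {z | ∏ j, expQuot (a j) z ≠ 0} ∈ 𝓝 (0 : ℂ) := by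
    have hprod : Differentiable ℂ fun z => ∏ j, expQuot (a j) z :=
      Differentiable.fun_finsetProd fun j _ => differentiable_expQuot (a j)
    refine (isOpen_ne_fun hprod.continuous continuous_const).mem_nhds ?_
    simp only [mem_ofPred_eq, expQuot_zero]
    exact Finset.prod_ne_zero_iff.2 fun j _ => by exact_mod_cast (ha j).ne'
  have hd := differentiableOn_barnesKernel a w
  have h0 : (fun t : ℝ => barnesKernel a w t) =O[𝓝[>] 0] (fun t : ℝ => t ^ (-(0 : ℝ))) := by
    have h1 : ContinuousAt (fun t : ℝ => barnesKernel a w t) 0 := by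
      refine ContinuousAt.comp (f := fun t : ℝ => (t : ℂ)) (g := barnesKernel a w) (x := 0) ?_
        Complex.continuous_ofReal.continuousAt
      exact (hd.differentiableAt hU).continuousAt
    simpa using (h1.tendsto.mono_left nhdsWithin_le_nhds).isBigO_one ℝ
  have hc : ContinuousOn (fun t : ℝ => barnesKernel a w t) (Ioi 0) :=
    hd.continuousOn.comp Complex.continuous_ofReal.continuousOn
      fun t ht => prod_expQuot_ne_zero ha (by simpa using ht)
  have h := mellinConvergent_of_isBigO_rpow_exp (s := s - M) (half_pos hw)
    (hc.locallyIntegrableOn measurableSet_Ioi)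
    (by simpa using iteratedDeriv_barnesKernel_isBigO ha hw 0) h0 (by simpa using hs)
  refine (integrableOn_congr_fun (fun t ht => ?_) measurableSet_Ioi).1 h
  exact (cpow_mul_prod_inv_eq_barnesKernel a w s ht).symm

theorem continuousOn_exp_mul_prod_inv {M : ℕ} {a : Fin M → ℝ} (ha : ∀ j, 0 < a j) (w : ℂ) :
    ContinuousOn (fun t : ℝ => Complex.exp (-(w * t)) * ∏ j, (1 - Complex.exp (-(a j * t)))⁻¹)
      (Ioi 0) := by
  refine ContinuousOn.mul (by fun_prop) (continuousOn_finsetProd _ fun j _ => ?_)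
  refine ContinuousOn.inv₀ (by fun_prop) fun t ht h => ?_
  have h1 := one_sub_exp_le_norm_one_sub_cexp (r := t) (ha j) (z := (t : ℂ)) (by simp)
  rw [h, norm_zero] at h1
  exact (one_sub_exp_neg_pos (ha j) ht).not_ge h1

theorem exp_mul_prod_inv_isBigO_rpow {M : ℕ} {a : Fin M → ℝ} (ha : ∀ j, 0 < a j) {w : ℂ}
    (hw : 0 < w.re) (r : ℝ) :
    (fun t : ℝ => Complex.exp (-(w * t)) * ∏ j, (1 - Complex.exp (-(a j * t)))⁻¹)
      =O[atTop] fun t : ℝ => t ^ r := by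
  have h1 : (fun t : ℝ => Complex.exp (-(w * t))) =O[atTop] fun t : ℝ => t ^ r := by
    refine (Asymptotics.IsBigO.of_bound 1 ?_).trans
      (isLittleO_exp_neg_mul_rpow_atTop hw r).isBigO
    filter_upwards with t
    rw [Complex.norm_exp, one_mul]
    simp
  have h2 : (fun t : ℝ => ∏ j, (1 - Complex.exp (-(a j * t)))⁻¹) =O[atTop]
      fun _ => (1 : ℝ) := by
    refine Asymptotics.IsBigO.of_bound (∏ j, (1 - Real.exp (-(a j * 1)))⁻¹) ?_
    filter_upwards [eventually_ge_atTop 1] with t ht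
    rw [norm_one, mul_one, norm_prod]
    refine Finset.prod_le_prod (fun j _ => norm_nonneg _) fun j _ => ?_
    rw [norm_inv]
    have := one_sub_exp_neg_pos (ha j) one_pos
    gcongr
    exact one_sub_exp_le_norm_one_sub_cexp (ha j) (by simpa using ht)
  simpa using h1.mul h2

/-- A linear combination of multiple log-gamma functions whose generating function
`G(t) = ∑ k, c_k exp (-w_k t) / ∏ j, (1 - exp (-a_j t))` vanishes at `0` is the integral of
`G(t) / t`. -/
theorem sum_mul_barnesLogGamma {ι : Type*} (S : Finset ι) {M : ℕ} {a : Fin M → ℝ}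
    (ha : ∀ j, 0 < a j) (c w : ι → ℂ) (hw : ∀ k ∈ S, 0 < (w k).re)
    (hG : (fun t : ℝ => ∑ k ∈ S, c k *
      (Complex.exp (-(w k * t)) * ∏ j, (1 - Complex.exp (-(a j * t)))⁻¹))
        =O[𝓝[>] 0] fun t : ℝ => t) :
    IntegrableOn (fun t : ℝ => (∑ k ∈ S, c k *
      (Complex.exp (-(w k * t)) * ∏ j, (1 - Complex.exp (-(a j * t)))⁻¹)) / t) (Ioi 0) ∧
    ∑ k ∈ S, c k * barnesLogGamma a (w k) = ∫ t in Ioi (0 : ℝ), (∑ k ∈ S, c k *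
      (Complex.exp (-(w k * t)) * ∏ j, (1 - Complex.exp (-(a j * t)))⁻¹)) / t := by
  set G : ℝ → ℂ := fun t : ℝ => ∑ k ∈ S, c k *
      (Complex.exp (-(w k * t)) * ∏ j, (1 - Complex.exp (-(a j * t)))⁻¹) with hGdef
  have hloc : LocallyIntegrableOn G (Ioi 0) :=
    (continuousOn_finsetSum S fun k _ =>
      (continuousOn_exp_mul_prod_inv ha (w k)).const_mul (c k)).locallyIntegrableOn
        measurableSet_Ioi
  have htop : ∀ r : ℝ, G =O[atTop] fun t : ℝ => t ^ (-r) := fun r =>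
    Asymptotics.IsBigO.fun_sum fun k hk =>
      (exp_mul_prod_inv_isBigO_rpow ha (hw k hk) (-r)).const_mul_left (c k)
  -- The exponent -1 makes the Mellin transform converge for Re s > -1, a half-plane containing s =
  -- 0.
  have hbot : G =O[𝓝[>] 0] fun t : ℝ => t ^ (-(-1 : ℝ)) := by simpa using hG
  have hdiff : ∀ s : ℂ, -1 < s.re → DifferentiableAt ℂ (mellin G) s := fun s hs =>
    mellin_differentiableAt_of_isBigO_rpow hloc (htop (s.re + 1)) (lt_add_one _) hbot hs
  have hconv : MellinConvergent G 0 :=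
    mellinConvergent_of_isBigO_rpow hloc (htop 1) (by simp) hbot (by simp)
  have hrw : ∀ t ∈ Ioi (0 : ℝ), (t : ℂ) ^ ((0 : ℂ) - 1) • G t = G t / t := fun t ht => by
    rw [zero_sub, Complex.cpow_neg_one, smul_eq_mul, div_eq_inv_mul]
  refine ⟨(integrableOn_congr_fun hrw measurableSet_Ioi).1 hconv, ?_⟩
  rw [← setIntegral_congr_fun measurableSet_Ioi hrw]
  change _ = mellin G 0
  let R : ℂ → ℂ := fun s => (Complex.Gamma s)⁻¹ * mellin G s
  let Z : ℂ → ℂ := fun s => ∑ k ∈ S, c k * barnesZeta a (w k) s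
  have hright : ∀ s : ℂ, (M : ℝ) < s.re → Z s = R s := by
    intro s hs
    simp only [Z, R, mellin]
    have : ∀ t : ℝ, (t : ℂ) ^ (s - 1) • G t = ∑ k ∈ S, c k * ((t : ℂ) ^ (s - 1) •
        (Complex.exp (-(w k * t)) * ∏ j, (1 - Complex.exp (-(a j * t)))⁻¹)) := fun t => by
      rw [hGdef, Finset.smul_sum]
      refine Finset.sum_congr rfl fun k _ => ?_
      simp only [smul_eq_mul]; ring
    simp_rw [this]
    rw [integral_finsetSum _ fun k hk =>
      (mellinConvergent_exp_mul_prod_inv ha (hw k hk) hs).const_mul (c k), Finset.mul_sum]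
    refine Finset.sum_congr rfl fun k hk => ?_
    rw [(isBarnesZeta_barnesZeta ha (hw k hk)).2 s hs, integral_const_mul, one_div]
    rw [mul_left_comm]
    congr 2
    refine setIntegral_congr_fun measurableSet_Ioi fun t ht => ?_
    rw [ofReal_prod_inv_eq a ht, mul_assoc, smul_eq_mul]
  -- A connected open set joining 0 to the region Re s > M while avoiding the possible poles 1, …,
  -- M: it leaves the strip |Re s| < 1 through the upper half-plane.
  let V : Set ℂ := {s | s.re ∈ Ioi (-1 : ℝ) ∧ s.im ∈ Ioi (0 : ℝ)} ∪ {s | s.re ∈ Ioo (-1 : ℝ) 1}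
  have hVo : IsOpen V :=
    ((isOpen_Ioi.preimage Complex.continuous_re).inter
      (isOpen_Ioi.preimage Complex.continuous_im)).union
      (isOpen_Ioo.preimage Complex.continuous_re)
  have hVp : IsPreconnected V := by
    refine IsPreconnected.union (Complex.I) (by simp) (by simp) ?_ ?_
    · exact (((convex_Ioi (-1 : ℝ)).linear_preimage Complex.reLm).inter
        ((convex_Ioi (0 : ℝ)).linear_preimage Complex.imLm)).isPreconnected
    · exact ((convex_Ioo (-1 : ℝ) 1).linear_preimage Complex.reLm).isPreconnected
  have hVre : ∀ s ∈ V, -1 < s.re := by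
    rintro s (⟨h, -⟩ | h)
    · exact h
    · exact h.1
  have hVm : ∀ s ∈ V, ∀ m : ℕ, m ∈ Finset.Icc 1 M → s ≠ (m : ℂ) := by
    rintro s hs m hm rfl
    rcases hs with ⟨-, h⟩ | h
    · simp at h
    · have h1 : (1 : ℝ) ≤ m := by exact_mod_cast (Finset.mem_Icc.1 hm).1
      have := h.2
      simp only [Complex.natCast_re] at this
      linarith
  have hset : IsOpen {s : ℂ | ∀ m : ℕ, m ∈ Finset.Icc 1 M → s ≠ (m : ℂ)} := by
    have : {s : ℂ | ∀ m : ℕ, m ∈ Finset.Icc 1 M → s ≠ (m : ℂ)} =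
        ⋂ m ∈ Finset.Icc 1 M, {s : ℂ | s ≠ (m : ℂ)} := by ext; simp
    rw [this]
    exact isOpen_biInter_finset fun m _ => isOpen_ne
  have hZat : ∀ k ∈ S, ∀ s ∈ V, DifferentiableAt ℂ (barnesZeta a (w k)) s := fun k hk s hs =>
    (isBarnesZeta_barnesZeta ha (hw k hk)).1.differentiableAt (hset.mem_nhds (hVm s hs))
  have hZd : DifferentiableOn ℂ Z V := fun s hs =>
    (DifferentiableAt.fun_sum fun k hk =>
      (hZat k hk s hs).const_mul (c k)).differentiableWithinAt
  have hRd : DifferentiableOn ℂ R V := fun s hs =>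
    ((Complex.differentiable_one_div_Gamma s).mul
      (hdiff s (hVre s hs))).differentiableWithinAt
  have h0V : (0 : ℂ) ∈ V := Or.inr (by simp)
  have hp : ((M : ℂ) + 1 + Complex.I) ∈ V := Or.inl (by
    have : (0 : ℝ) ≤ M := Nat.cast_nonneg M
    constructor <;> simp; linarith)
  have hEq : EqOn Z R V := by
    refine (hZd.analyticOnNhd hVo).eqOn_of_preconnected_of_eventuallyEq
      (hRd.analyticOnNhd hVo) hVp hp ?_
    have : {s : ℂ | (M : ℝ) < s.re} ∈ 𝓝 ((M : ℂ) + 1 + Complex.I) :=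
      (isOpen_lt continuous_const Complex.continuous_re).mem_nhds (by simp)
    filter_upwards [this] with s hs using hright s hs
  have hderivZ : deriv Z 0 = ∑ k ∈ S, c k * barnesLogGamma a (w k) := by
    have := HasDerivAt.fun_sum fun k hk => ((hZat k hk 0 h0V).hasDerivAt).const_mul (c k)
    exact this.deriv
  rw [← hderivZ, (hEq.eventuallyEq_of_mem (hVo.mem_nhds h0V)).deriv_eq]
  -- The explicit factor s reduces the derivative at 0 to the value of the cofactor there, and Γ(1)
  -- = 1.
  have hR : R = fun s => s * ((Complex.Gamma (s + 1))⁻¹ * mellin G s) := by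
    funext s
    simp only [R]
    rw [Complex.one_div_Gamma_eq_self_mul_one_div_Gamma_add_one, mul_assoc]
  have h2 : DifferentiableAt ℂ (fun s : ℂ => (Complex.Gamma (s + 1))⁻¹ * mellin G s) 0 :=
    ((Complex.differentiable_one_div_Gamma.comp (by fun_prop : Differentiable ℂ
      fun s : ℂ => s + 1)) 0).mul (hdiff 0 (by simp))
  have h3 : HasDerivAt (fun s : ℂ => s * ((Complex.Gamma (s + 1))⁻¹ * mellin G s)) _ 0 :=
    (hasDerivAt_id (0 : ℂ)).mul h2.hasDerivAt
  rw [hR, h3.deriv]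
  simp

/-! ### The Gamma integral with complex rate, and L_0 -/

theorem integrableOn_rpow_mul_exp_neg_mul {x ρ : ℝ} (hx : 0 < x) (hρ : 0 < ρ) :
    IntegrableOn (fun t : ℝ => t ^ (x - 1) * Real.exp (-(ρ * t))) (Ioi 0) := by
  have := integrableOn_rpow_mul_exp_neg_mul_rpow (s := x - 1) (p := 1) (b := ρ) (by linarith)
    one_pos hρ
  simpa using this

theorem norm_cpow_mul_cexp_neg_mul (s r : ℂ) {t : ℝ} (ht : 0 < t) :
    ‖(t : ℂ) ^ (s - 1) * Complex.exp (-(r * t))‖ = t ^ (s.re - 1) * Real.exp (-(r.re * t)) := by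
  rw [norm_mul, Complex.norm_cpow_eq_rpow_re_of_pos ht, Complex.norm_exp]
  simp

theorem continuousOn_cpow_mul_cexp_neg_mul (s r : ℂ) :
    ContinuousOn (fun t : ℝ => (t : ℂ) ^ (s - 1) * Complex.exp (-(r * t))) (Ioi 0) := by
  refine ContinuousOn.mul (fun t ht => ?_) (by fun_prop)
  exact (Complex.continuousAt_ofReal_cpow_const t _
    (Or.inr (ne_of_gt ht))).continuousWithinAt

theorem integrableOn_cpow_mul_cexp_neg_mul {s r : ℂ} (hs : 0 < s.re) (hr : 0 < r.re) :
    IntegrableOn (fun t : ℝ => (t : ℂ) ^ (s - 1) * Complex.exp (-(r * t))) (Ioi 0) := by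
  refine (integrableOn_rpow_mul_exp_neg_mul hs hr).mono'
    ((continuousOn_cpow_mul_cexp_neg_mul s r).aestronglyMeasurable measurableSet_Ioi) ?_
  filter_upwards [ae_restrict_mem measurableSet_Ioi] with t ht
  exact (norm_cpow_mul_cexp_neg_mul s r ht).le

theorem differentiableAt_integral_cpow_mul_cexp {s r : ℂ} (hs : 0 < s.re) (hr : 0 < r.re) :
    DifferentiableAt ℂ
      (fun r : ℂ => ∫ t in Ioi (0 : ℝ), (t : ℂ) ^ (s - 1) * Complex.exp (-(r * t))) r := by
  have hball : ∀ z ∈ Metric.ball r (r.re / 2), r.re / 2 < z.re := fun z hz => by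
    rw [Metric.mem_ball, dist_eq_norm] at hz
    have h1 := (Complex.abs_re_le_norm (z - r)).trans_lt hz
    rw [Complex.sub_re] at h1
    linarith [(abs_lt.1 h1).1]
  refine (hasDerivAt_integral_of_dominated_loc_of_deriv_le
    (F' := fun r t => -((t : ℂ) ^ (s + 1 - 1) * Complex.exp (-(r * t))))
    (bound := fun t => t ^ ((s + 1).re - 1) * Real.exp (-(r.re / 2 * t)))
    (Metric.ball_mem_nhds r (half_pos hr)) (Eventually.of_forall fun z =>
      (continuousOn_cpow_mul_cexp_neg_mul s z).aestronglyMeasurable measurableSet_Ioi)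
    (integrableOn_cpow_mul_cexp_neg_mul hs hr)
    ((continuousOn_cpow_mul_cexp_neg_mul (s + 1) r).aestronglyMeasurable measurableSet_Ioi).neg
    ?_ (integrableOn_rpow_mul_exp_neg_mul (by simp; linarith) (half_pos hr)) ?_).2.differentiableAt
  · filter_upwards [ae_restrict_mem measurableSet_Ioi] with t ht z hz
    rw [norm_neg, norm_cpow_mul_cexp_neg_mul _ _ ht]
    have : (0 : ℝ) < t := ht
    gcongr
    exact (hball z hz).le
  · filter_upwards [ae_restrict_mem measurableSet_Ioi] with t ht z hz
    have ht0 : (t : ℂ) ≠ 0 := by exact_mod_cast (ne_of_gt ht)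
    have h1 : HasDerivAt (fun z : ℂ => -(z * t)) (-(1 * t)) z :=
      ((hasDerivAt_id z).mul_const (t : ℂ)).neg
    refine (h1.cexp.const_mul ((t : ℂ) ^ (s - 1))).congr_deriv ?_
    rw [show s + 1 - 1 = s - 1 + 1 by ring, Complex.cpow_add _ _ ht0, Complex.cpow_one]
    ring

/-- Both sides are holomorphic in r on the right half-plane, and they agree at positive real r,
which accumulate at 1; the identity theorem does the rest. -/
theorem integral_cpow_mul_cexp_neg_mul_Ioi {s r : ℂ} (hs : 0 < s.re) (hr : 0 < r.re) :
    ∫ t in Ioi (0 : ℝ), (t : ℂ) ^ (s - 1) * Complex.exp (-(r * t)) =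
      (1 / r) ^ s * Complex.Gamma s := by
  have hV : IsOpen {z : ℂ | 0 < z.re} := isOpen_lt continuous_const Complex.continuous_re
  have hVp : IsPreconnected {z : ℂ | 0 < z.re} :=
    ((convex_Ioi (0 : ℝ)).linear_preimage Complex.reLm).isPreconnected
  have hslit : ∀ z : ℂ, 0 < z.re → 1 / z ∈ Complex.slitPlane := fun z hz => by
    rw [one_div]
    refine Or.inl ?_
    rw [Complex.inv_re]
    exact div_pos hz (Complex.normSq_pos.2 fun h => by simp [h] at hz)
  have h1 : AnalyticOnNhd ℂ
      (fun r : ℂ => ∫ t in Ioi (0 : ℝ), (t : ℂ) ^ (s - 1) * Complex.exp (-(r * t)))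
      {z : ℂ | 0 < z.re} :=
    DifferentiableOn.analyticOnNhd (fun z hz =>
      (differentiableAt_integral_cpow_mul_cexp hs hz).differentiableWithinAt) hV
  have h2 : AnalyticOnNhd ℂ (fun r : ℂ => (1 / r) ^ s * Complex.Gamma s) {z : ℂ | 0 < z.re} := by
    refine DifferentiableOn.analyticOnNhd (fun z hz => ?_) hV
    have hz0 : z ≠ 0 := fun h => by simp [h] at hz
    exact ((((differentiableAt_const (1 : ℂ)).div differentiableAt_id hz0).cpow_const
      (hslit z hz)).mul_const _).differentiableWithinAt
  refine h1.eqOn_of_preconnected_of_frequently_eq h2 hVp (z₀ := 1) (by simp) ?_ hr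
  have ht : Tendsto (fun t : ℝ => (t : ℂ)) (𝓝[≠] 1) (𝓝[≠] 1) := by
    refine tendsto_nhdsWithin_iff.2 ⟨?_, ?_⟩
    · have := (Complex.continuous_ofReal.tendsto (1 : ℝ)).mono_left
        (nhdsWithin_le_nhds (s := {1}ᶜ))
      simpa using this
    · filter_upwards [self_mem_nhdsWithin] with t ht
      simpa using ht
  refine ht.frequently (Eventually.frequently ?_)
  filter_upwards [nhdsWithin_le_nhds (lt_mem_nhds (one_pos : (0 : ℝ) < 1))] with t ht
  exact Complex.integral_cpow_mul_exp_neg_mul_Ioi hs ht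

/-- With no parameters the zeta function is w^(-s). This value turns the general integral formula
with M = N = 0 into Frullani's integral. -/
theorem barnesLogGamma_zero_params (a : Fin 0 → ℝ) {w : ℂ} (hw : 0 < w.re) :
    barnesLogGamma a w = -Complex.log w := by
  have hw0 : w ≠ 0 := fun h => by simp [h] at hw
  have hZ := isBarnesZeta_barnesZeta (a := a) (fun j => j.elim0) hw
  have hd : Differentiable ℂ (barnesZeta a w) := by
    have := hZ.1
    rw [show {s : ℂ | ∀ m : ℕ, m ∈ Finset.Icc 1 0 → s ≠ (m : ℂ)} = univ by ext; simp] at this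
    exact differentiableOn_univ.1 this
  have hd' : Differentiable ℂ fun s : ℂ => (1 / w) ^ s := fun s =>
    DifferentiableAt.const_cpow differentiableAt_id (Or.inl (by simpa using hw0))
  have heq : barnesZeta a w = fun s => (1 / w) ^ s := by
    refine AnalyticOnNhd.eq_of_eventuallyEq (z₀ := 1)
      (hd.differentiableOn.analyticOnNhd isOpen_univ)
      (hd'.differentiableOn.analyticOnNhd isOpen_univ) ?_
    have : {s : ℂ | 0 < s.re} ∈ 𝓝 (1 : ℂ) :=
      (isOpen_lt continuous_const Complex.continuous_re).mem_nhds (by simp)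
    filter_upwards [this] with s hs
    rw [hZ.2 s (by simpa using hs)]
    have h := integral_cpow_mul_cexp_neg_mul_Ioi hs hw
    simp only [barnesF, pow_zero, Finset.univ_eq_empty, Finset.prod_empty]
    simp only [mul_one, div_one, Complex.ofReal_one]
    rw [h, mul_comm, mul_assoc, mul_one_div_cancel (Complex.Gamma_ne_zero_of_re_pos hs), mul_one]
  have hder : HasDerivAt (fun s : ℂ => (1 / w) ^ s) _ 0 :=
    (hasDerivAt_id (0 : ℂ)).const_cpow (c := 1 / w) (Or.inl (by simpa using hw0))
  rw [barnesLogGamma, heq, hder.deriv]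
  have harg : w.arg ≠ Real.pi := by
    have := Complex.abs_arg_lt_pi_div_two_iff.2 (Or.inl hw)
    have h2 := (abs_lt.1 this).2
    linarith [Real.pi_pos]
  simp [Complex.log_inv _ harg]

/-! ### The quotient F and the integral form of S_N L_M -/

/-- The quotient `∏ j, (1 - exp (-b_j t)) / ∏ j, (1 - exp (-a_j t))`. -/
noncomputable def expProdQuot {M N : ℕ} (a : Fin M → ℝ) (b : Fin N → ℝ) (t : ℝ) : ℝ :=
  (∏ j, (1 - Real.exp (-(b j * t)))) * ∏ j, (1 - Real.exp (-(a j * t)))⁻¹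

theorem mul_exp_neg_le_one_sub_exp_neg (x : ℝ) : x * Real.exp (-x) ≤ 1 - Real.exp (-x) := by
  have h1 := Real.add_one_le_exp x
  have h2 : Real.exp x * Real.exp (-x) = 1 := by rw [← Real.exp_add]; simp
  nlinarith [Real.exp_pos (-x)]

theorem one_sub_exp_neg_le (x : ℝ) : 1 - Real.exp (-x) ≤ x := by
  linarith [Real.add_one_le_exp (-x)]

section

variable {M N : ℕ} {a : Fin M → ℝ} {b : Fin N → ℝ}

theorem expProdQuot_pos (ha : ∀ j, 0 < a j) (hb : ∀ j, 0 < b j) {t : ℝ} (ht : 0 < t) :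
    0 < expProdQuot a b t :=
  mul_pos (Finset.prod_pos fun j _ => one_sub_exp_neg_pos (hb j) ht)
    (Finset.prod_pos fun j _ => inv_pos.2 (one_sub_exp_neg_pos (ha j) ht))

/-- Factorwise from x e^(-x) ≤ 1 - e^(-x) ≤ x. The lower bound `le_expProdQuot` has the same
constant K = ∏ b_j / ∏ a_j, so for M = N the limit of F at 0 is exactly K. -/
theorem expProdQuot_le (hMN : M ≤ N) (ha : ∀ j, 0 < a j) (hb : ∀ j, 0 < b j) {t : ℝ}
    (ht : 0 < t) :
    expProdQuot a b t ≤
      (∏ j, b j) * (∏ j, (a j)⁻¹) * t ^ (N - M) * Real.exp ((∑ j, a j) * t) := by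
  have h1 : ∏ j, (1 - Real.exp (-(b j * t))) ≤ ∏ j, (b j * t) :=
    Finset.prod_le_prod (fun j _ => (one_sub_exp_neg_pos (hb j) ht).le)
      fun j _ => one_sub_exp_neg_le _
  have h2 : ∏ j, (1 - Real.exp (-(a j * t)))⁻¹ ≤
      ∏ j, ((a j)⁻¹ * t⁻¹ * Real.exp (a j * t)) := by
    refine Finset.prod_le_prod (fun j _ => (inv_pos.2 (one_sub_exp_neg_pos (ha j) ht)).le)
      fun j _ => ?_
    have h3 := mul_exp_neg_le_one_sub_exp_neg (a j * t)
    have h4 := ha j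
    have h5 : (a j)⁻¹ * t⁻¹ * Real.exp (a j * t) = (a j * t * Real.exp (-(a j * t)))⁻¹ := by
      rw [Real.exp_neg]; field_simp
    rw [h5]
    gcongr
  have h6 : 0 ≤ ∏ j, (1 - Real.exp (-(a j * t)))⁻¹ :=
    (Finset.prod_pos fun j _ => inv_pos.2 (one_sub_exp_neg_pos (ha j) ht)).le
  have h7 : 0 ≤ ∏ j, (b j * t) := (Finset.prod_pos fun j _ => mul_pos (hb j) ht).le
  refine (mul_le_mul h1 h2 h6 h7).trans (le_of_eq ?_)
  simp only [Finset.prod_mul_distrib, Finset.prod_const, Finset.card_univ, Fintype.card_fin,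
    ← Real.exp_sum, Finset.sum_mul]
  have : t ^ N = t ^ (N - M) * t ^ M := by rw [← pow_add, Nat.sub_add_cancel hMN]
  have h8 : t ^ M * t⁻¹ ^ M = 1 := by rw [← mul_pow, mul_inv_cancel₀ ht.ne', one_pow]
  rw [this]
  linear_combination (∏ j, b j) * (∏ j, (a j)⁻¹) * t ^ (N - M) * Real.exp (∑ j, a j * t) * h8

theorem le_expProdQuot (hMN : M ≤ N) (ha : ∀ j, 0 < a j) (hb : ∀ j, 0 < b j) {t : ℝ}
    (ht : 0 < t) :
    (∏ j, b j) * (∏ j, (a j)⁻¹) * t ^ (N - M) * Real.exp (-((∑ j, b j) * t)) ≤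
      expProdQuot a b t := by
  have h1 : ∏ j, (b j * t * Real.exp (-(b j * t))) ≤ ∏ j, (1 - Real.exp (-(b j * t))) :=
    Finset.prod_le_prod (fun j _ => by have := hb j; positivity)
      fun j _ => mul_exp_neg_le_one_sub_exp_neg _
  have h2 : ∏ j, ((a j)⁻¹ * t⁻¹) ≤ ∏ j, (1 - Real.exp (-(a j * t)))⁻¹ := by
    refine Finset.prod_le_prod (fun j _ => by have := ha j; positivity) fun j _ => ?_
    rw [← mul_inv]
    have := one_sub_exp_neg_pos (ha j) ht
    gcongr
    exact one_sub_exp_neg_le _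
  have h6 : 0 ≤ ∏ j, ((a j)⁻¹ * t⁻¹) :=
    Finset.prod_nonneg fun j _ => by have := ha j; positivity
  have h7 : 0 ≤ ∏ j, (1 - Real.exp (-(b j * t))) :=
    (Finset.prod_pos fun j _ => one_sub_exp_neg_pos (hb j) ht).le
  refine (le_of_eq ?_).trans (mul_le_mul h1 h2 h6 h7)
  simp only [Finset.prod_mul_distrib, Finset.prod_const, Finset.card_univ, Fintype.card_fin,
    ← Real.exp_sum, Finset.sum_mul, Finset.sum_neg_distrib]
  have : t ^ N = t ^ (N - M) * t ^ M := by rw [← pow_add, Nat.sub_add_cancel hMN]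
  have h8 : t ^ M * t⁻¹ ^ M = 1 := by rw [← mul_pow, mul_inv_cancel₀ ht.ne', one_pow]
  rw [this]
  linear_combination
    -((∏ j, b j) * (∏ j, (a j)⁻¹) * t ^ (N - M) * Real.exp (-∑ j, b j * t)) * h8

theorem expProdQuot_le_of_one_le (ha : ∀ j, 0 < a j) (hb : ∀ j, 0 < b j) {t : ℝ} (ht : 1 ≤ t) :
    expProdQuot a b t ≤ ∏ j, (1 - Real.exp (-(a j)))⁻¹ := by
  have ht0 : 0 < t := by linarith
  have h1 : ∏ j, (1 - Real.exp (-(b j * t))) ≤ 1 :=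
    Finset.prod_le_one (fun j _ => (one_sub_exp_neg_pos (hb j) ht0).le)
      fun j _ => by linarith [Real.exp_pos (-(b j * t))]
  have h2 : ∏ j, (1 - Real.exp (-(a j * t)))⁻¹ ≤ ∏ j, (1 - Real.exp (-(a j)))⁻¹ := by
    refine Finset.prod_le_prod (fun j _ => (inv_pos.2 (one_sub_exp_neg_pos (ha j) ht0)).le)
      fun j _ => ?_
    have h3 := one_sub_exp_neg_pos (ha j) one_pos
    rw [mul_one] at h3
    gcongr
    nlinarith [ha j]
  have h6 : 0 ≤ ∏ j, (1 - Real.exp (-(a j * t)))⁻¹ :=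
    (Finset.prod_pos fun j _ => inv_pos.2 (one_sub_exp_neg_pos (ha j) ht0)).le
  simpa [expProdQuot] using mul_le_mul h1 h2 h6 zero_le_one

theorem expProdQuot_isBigO (hMN : M ≤ N) (ha : ∀ j, 0 < a j) (hb : ∀ j, 0 < b j) :
    (fun t : ℝ => (expProdQuot a b t : ℂ)) =O[𝓝[>] 0] fun t : ℝ => t ^ (N - M) := by
  refine Asymptotics.IsBigO.of_bound
    ((∏ j, b j) * (∏ j, (a j)⁻¹) * Real.exp (∑ j, a j)) ?_
  filter_upwards [Ioo_mem_nhdsGT (one_pos : (0 : ℝ) < 1)] with t ht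
  have hK : 0 ≤ (∏ j, b j) * (∏ j, (a j)⁻¹) :=
    mul_nonneg (Finset.prod_nonneg fun j _ => (hb j).le)
      (Finset.prod_nonneg fun j _ => (inv_pos.2 (ha j)).le)
  have hA : 0 ≤ ∑ j, a j := Finset.sum_nonneg fun j _ => (ha j).le
  rw [Complex.norm_real, Real.norm_of_nonneg (expProdQuot_pos ha hb ht.1).le,
    Real.norm_of_nonneg (pow_nonneg ht.1.le _)]
  refine (expProdQuot_le hMN ha hb ht.1).trans ?_
  rw [mul_right_comm]
  have := ht.1
  gcongr
  nlinarith [ht.2]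

theorem barnesS_eq_sum_powerset (f : ℂ → ℂ) (q : ℂ) (b₀ : ℝ) (b : Fin N → ℝ) :
    barnesS f q b₀ b = ∑ J ∈ (Finset.univ : Finset (Fin N)).powerset,
      (-1) ^ J.card * f (q + b₀ + ∑ j ∈ J, (b j : ℂ)) := by
  rw [barnesS, Finset.sum_powerset, Finset.card_univ, Fintype.card_fin]
  refine Finset.sum_congr rfl fun p _ => ?_
  rw [Finset.mul_sum]
  refine Finset.sum_congr rfl fun J hJ => ?_
  rw [(Finset.mem_powersetCard.1 hJ).2]

/-- Inclusion-exclusion: the subsets J index the terms in the expanded product of the factors 1 -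
e^(-b_j t). -/
theorem sum_powerset_exp (q : ℂ) (b₀ : ℝ) (b : Fin N → ℝ) (t : ℝ) :
    ∑ J ∈ (Finset.univ : Finset (Fin N)).powerset,
      (-1) ^ J.card * Complex.exp (-((q + b₀ + ∑ j ∈ J, (b j : ℂ)) * t)) =
    Complex.exp (-((q + b₀) * t)) * ∏ j, (1 - Complex.exp (-(b j * t))) := by
  simp only [sub_eq_add_neg]
  rw [Finset.prod_one_add, Finset.mul_sum]
  refine Finset.sum_congr rfl fun J _ => ?_
  rw [Finset.prod_neg, ← Complex.exp_sum, mul_left_comm, ← Complex.exp_add,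
    Finset.sum_neg_distrib, ← Finset.sum_mul]
  ring_nf

/-- A linear combination of values of `S_N L_M` as an integral. -/
theorem sum_mul_barnesS_barnesLogGamma {ε : Type*} (E : Finset ε) (ha : ∀ j, 0 < a j)
    (hb : ∀ j, 0 < b j) {b₀ : ℝ} (d q : ε → ℂ) (hq : ∀ e ∈ E, -b₀ < (q e).re)
    (hO : (fun t : ℝ => (∑ e ∈ E, d e * Complex.exp (-((q e + b₀) * t))) *
      (expProdQuot a b t : ℂ)) =O[𝓝[>] 0] fun t : ℝ => t) :
    IntegrableOn (fun t : ℝ => (∑ e ∈ E, d e * Complex.exp (-((q e + b₀) * t))) *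
      (expProdQuot a b t : ℂ) / t) (Ioi 0) ∧
    ∑ e ∈ E, d e * barnesS (barnesLogGamma a) (q e) b₀ b =
      ∫ t in Ioi (0 : ℝ), (∑ e ∈ E, d e * Complex.exp (-((q e + b₀) * t))) *
        (expProdQuot a b t : ℂ) / t := by
  have hfun : (fun t : ℝ => (∑ e ∈ E, d e * Complex.exp (-((q e + b₀) * t))) *
      (expProdQuot a b t : ℂ)) = fun t : ℝ =>
      ∑ k ∈ E ×ˢ (Finset.univ : Finset (Fin N)).powerset, (d k.1 * (-1) ^ k.2.card) *
        (Complex.exp (-((q k.1 + b₀ + ∑ j ∈ k.2, (b j : ℂ)) * t)) *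
          ∏ j, (1 - Complex.exp (-(a j * t)))⁻¹) := by
    funext t
    rw [Finset.sum_product, Finset.sum_mul]
    refine Finset.sum_congr rfl fun e _ => ?_
    have h : (expProdQuot a b t : ℂ) = (∏ j, (1 - Complex.exp (-(b j * t)))) *
        ∏ j, (1 - Complex.exp (-(a j * t)))⁻¹ := by
      rw [expProdQuot]; push_cast; rfl
    rw [h, mul_assoc, ← mul_assoc (Complex.exp _), ← sum_powerset_exp, Finset.sum_mul,
      Finset.mul_sum]
    refine Finset.sum_congr rfl fun J _ => ?_
    ring
  have key := sum_mul_barnesLogGamma (E ×ˢ (Finset.univ : Finset (Fin N)).powerset) ha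
    (fun k => d k.1 * (-1) ^ k.2.card) (fun k => q k.1 + b₀ + ∑ j ∈ k.2, (b j : ℂ))
    (fun k hk => by
      have h1 := hq k.1 (Finset.mem_product.1 hk).1
      have h2 : 0 ≤ ∑ j ∈ k.2, b j := Finset.sum_nonneg fun j _ => (hb j).le
      simp only [Complex.add_re, Complex.ofReal_re, Complex.re_sum]
      linarith) (by rwa [hfun] at hO)
  simp only [← congrFun hfun] at key
  refine ⟨key.1, ?_⟩
  rw [← key.2, Finset.sum_product]
  refine Finset.sum_congr rfl fun e _ => ?_
  rw [barnesS_eq_sum_powerset, Finset.mul_sum]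
  refine Finset.sum_congr rfl fun J _ => ?_
  ring

/-- For M < N the quotient F already vanishes at 0, so no subtraction is needed. -/
theorem barnesS_barnesLogGamma (hMN : M < N) (ha : ∀ j, 0 < a j) (hb : ∀ j, 0 < b j) {b₀ : ℝ}
    {q : ℂ} (hq : -b₀ < q.re) :
    barnesS (barnesLogGamma a) q b₀ b =
      ∫ t in Ioi (0 : ℝ), Complex.exp (-((q + b₀) * t)) * (expProdQuot a b t : ℂ) / t := by
  have h := (sum_mul_barnesS_barnesLogGamma (Finset.univ : Finset Unit) ha hb (b₀ := b₀)
    (fun _ => 1) (fun _ => q) (fun _ _ => hq) ?_).2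
  · simpa using h
  · have h1 : (fun t : ℝ => Complex.exp (-((q + b₀) * t))) =O[𝓝[>] 0] fun _ => (1 : ℝ) := by
      have : ContinuousAt (fun t : ℝ => Complex.exp (-((q + b₀) * t))) 0 := by fun_prop
      exact (this.tendsto.mono_left nhdsWithin_le_nhds).isBigO_one ℝ
    have h2 := expProdQuot_isBigO hMN.le ha hb
    have h3 : (fun t : ℝ => t ^ (N - M)) =O[𝓝[>] 0] fun t : ℝ => t := by
      refine Asymptotics.IsBigO.of_bound 1 ?_
      filter_upwards [Ioo_mem_nhdsGT (one_pos : (0 : ℝ) < 1)] with t ht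
      rw [one_mul, norm_pow, Real.norm_of_nonneg ht.1.le]
      exact pow_le_of_le_one ht.1.le ht.2.le (by omega)
    simpa using h1.mul (h2.trans h3)

/-- The difference of exponentials is O(t) at 0 and F is bounded there, so the case M = N is covered
too. -/
theorem barnesS_barnesLogGamma_sub (hMN : M ≤ N) (ha : ∀ j, 0 < a j) (hb : ∀ j, 0 < b j)
    {b₀ : ℝ} {q q' : ℂ} (hq : -b₀ < q.re) (hq' : -b₀ < q'.re) :
    IntegrableOn (fun t : ℝ => (Complex.exp (-((q + b₀) * t)) - Complex.exp (-((q' + b₀) * t))) *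
      (expProdQuot a b t : ℂ) / t) (Ioi 0) ∧
    barnesS (barnesLogGamma a) q b₀ b - barnesS (barnesLogGamma a) q' b₀ b =
      ∫ t in Ioi (0 : ℝ), (Complex.exp (-((q + b₀) * t)) - Complex.exp (-((q' + b₀) * t))) *
        (expProdQuot a b t : ℂ) / t := by
  have h := (sum_mul_barnesS_barnesLogGamma (Finset.univ : Finset Bool) ha hb (b₀ := b₀)
    (fun e => cond e 1 (-1)) (fun e => cond e q q') (fun e _ => by cases e <;> assumption) ?_)
  · simpa [sub_eq_add_neg] using h
  · have h1 : (fun t : ℝ => Complex.exp (-((q + b₀) * t)) - Complex.exp (-((q' + b₀) * t)))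
        =O[𝓝[>] 0] fun t : ℝ => t := by
      have : DifferentiableAt ℝ (fun t : ℝ =>
        Complex.exp (-((q + b₀) * t)) - Complex.exp (-((q' + b₀) * t))) 0 := by fun_prop
      simpa using this.isBigO_sub.mono nhdsWithin_le_nhds
    have h2 := expProdQuot_isBigO hMN ha hb
    have h3 : (fun t : ℝ => t ^ (N - M)) =O[𝓝[>] 0] fun _ : ℝ => (1 : ℝ) := by
      have : ContinuousAt (fun t : ℝ => t ^ (N - M)) 0 := by fun_prop
      exact (this.tendsto.mono_left nhdsWithin_le_nhds).isBigO_one ℝ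
    simpa [sub_eq_add_neg] using h1.mul (h2.trans h3)

end

/-! ### Compound Poisson laws -/

theorem norm_cexp_neg_mul_ofReal (q : ℂ) (x : ℝ) :
    ‖Complex.exp (-(q * x))‖ = Real.exp (-(q.re * x)) := by
  rw [Complex.norm_exp]; simp

theorem integrable_pi_cexp (ν : Measure ℝ) [IsFiniteMeasure ν] {q : ℂ}
    (hq : Integrable (fun x : ℝ => Complex.exp (-(q * x))) ν) (n : ℕ) :
    Integrable (fun x : Fin n → ℝ => Complex.exp (-(q * ((∑ i, x i : ℝ) : ℂ))))
      (Measure.pi fun _ => ν) := by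
  have := Integrable.fintype_prod (ι := Fin n) (μ := fun _ => ν) (fun _ => hq)
  refine this.congr (Eventually.of_forall fun x => ?_)
  beta_reduce
  rw [← Complex.exp_sum, Finset.sum_neg_distrib, Complex.ofReal_sum, Finset.mul_sum]

theorem integral_pi_cexp (ν : Measure ℝ) [IsFiniteMeasure ν] (q : ℂ) (n : ℕ) :
    ∫ x : Fin n → ℝ, Complex.exp (-(q * ((∑ i, x i : ℝ) : ℂ))) ∂(Measure.pi fun _ => ν) =
      (∫ x, Complex.exp (-(q * x)) ∂ν) ^ n := by
  have := integral_fintype_prod_eq_pow (ι := Fin n) (μ := ν)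
    (fun x : ℝ => Complex.exp (-(q * x)))
  rw [Fintype.card_fin] at this
  rw [← this]
  refine integral_congr_ae (Eventually.of_forall fun x => ?_)
  beta_reduce
  rw [← Complex.exp_sum, Finset.sum_neg_distrib, Complex.ofReal_sum, Finset.mul_sum]

theorem integral_pi_norm_cexp (ν : Measure ℝ) [IsFiniteMeasure ν] (q : ℂ) (n : ℕ) :
    ∫ x : Fin n → ℝ, ‖Complex.exp (-(q * ((∑ i, x i : ℝ) : ℂ)))‖ ∂(Measure.pi fun _ => ν) =
      (∫ x, Real.exp (-(q.re * x)) ∂ν) ^ n := by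
  have := integral_fintype_prod_eq_pow (ι := Fin n) (μ := ν)
    (fun x : ℝ => Real.exp (-(q.re * x)))
  rw [Fintype.card_fin] at this
  rw [← this]
  refine integral_congr_ae (Eventually.of_forall fun x => ?_)
  beta_reduce
  rw [norm_cexp_neg_mul_ofReal, ← Real.exp_sum, Finset.sum_neg_distrib, Finset.mul_sum]

theorem measurable_cexp_neg_mul (q : ℂ) : Measurable fun x : ℝ => Complex.exp (-(q * x)) := by
  fun_prop

/-- The compound Poisson distribution with finite jump measure `ν`. -/
noncomputable def compoundPoisson (ν : Measure ℝ) : Measure ℝ :=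
  Measure.sum fun n : ℕ => ENNReal.ofReal (Real.exp (-ν.real univ) / n.factorial) •
    (Measure.pi fun _ : Fin n => ν).map fun x => ∑ i, x i

section

variable (ν : Measure ℝ) [IsFiniteMeasure ν]

theorem isProbabilityMeasure_compoundPoisson : IsProbabilityMeasure (compoundPoisson ν) := by
  constructor
  rw [compoundPoisson, Measure.sum_apply _ MeasurableSet.univ]
  have h : ∀ n : ℕ, (ENNReal.ofReal (Real.exp (-ν.real univ) / n.factorial) •
      (Measure.pi fun _ : Fin n => ν).map fun x => ∑ i, x i) univ =
      ENNReal.ofReal (Real.exp (-ν.real univ) * (ν.real univ ^ n / n.factorial)) := fun n => by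
    rw [Measure.smul_apply, Measure.map_apply (by fun_prop) MeasurableSet.univ, preimage_univ,
      Measure.pi_univ, Finset.prod_const, Finset.card_univ, Fintype.card_fin,
      ← ofReal_measureReal, smul_eq_mul, ← ENNReal.ofReal_pow measureReal_nonneg,
      ← ENNReal.ofReal_mul (by positivity)]
    congr 1
    ring
  simp_rw [h]
  rw [← ENNReal.ofReal_tsum_of_nonneg (fun n => by positivity)
    ((Real.summable_pow_div_factorial _).mul_left _), tsum_mul_left]
  have := (NormedSpace.expSeries_div_hasSum_exp (ν.real univ)).tsum_eq
  rw [this, ← Real.exp_eq_exp_ℝ, ← Real.exp_add]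
  simp

theorem ae_nonneg_compoundPoisson (hν : ∀ᵐ x ∂ν, 0 ≤ x) :
    ∀ᵐ x ∂(compoundPoisson ν), 0 ≤ x := by
  rw [compoundPoisson, Measure.ae_sum_iff]
  refine fun n => Measure.ae_smul_measure ?_ _
  refine (ae_map_iff (by fun_prop) measurableSet_Ici).2 ?_
  have : ∀ i : Fin n, ∀ᵐ x ∂(Measure.pi fun _ : Fin n => ν), 0 ≤ x i := fun i =>
    (Measure.quasiMeasurePreserving_eval (fun _ => ν) i).ae hν
  filter_upwards [ae_all_iff.2 this] with x hx
  exact Finset.sum_nonneg fun i _ => hx i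

/-- By independence the n-jump term contributes the n-th power of ∫ e^(-qx) dν over n!, so the sum
is an exponential series. The same series with Re q gives absolute convergence. -/
theorem compoundPoisson_laplace {q : ℂ}
    (hq : Integrable (fun x : ℝ => Complex.exp (-(q * x))) ν) :
    Integrable (fun x : ℝ => Complex.exp (-(q * x))) (compoundPoisson ν) ∧
    ∫ x : ℝ, Complex.exp (-(q * x)) ∂(compoundPoisson ν) =
      Complex.exp (∫ x : ℝ, (Complex.exp (-(q * x)) - 1) ∂ν) := by
  have hm : ∀ n : ℕ, Measurable fun x : Fin n → ℝ => ∑ i, x i := fun n => by fun_prop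
  have hint : Integrable (fun x : ℝ => Complex.exp (-(q * x))) (compoundPoisson ν) := by
    refine integrable_sum_measure (fun n => Integrable.smul_measure ?_ ENNReal.ofReal_ne_top) ?_
    · rw [integrable_map_measure (measurable_cexp_neg_mul q).aestronglyMeasurable
        (hm n).aemeasurable]
      exact integrable_pi_cexp ν hq n
    · refine ((Real.summable_pow_div_factorial (∫ x, Real.exp (-(q.re * x)) ∂ν)).mul_left
        (Real.exp (-ν.real univ))).congr fun n => ?_
      rw [integral_smul_measure, integral_map (hm n).aemeasurable
        (measurable_cexp_neg_mul q).norm.aestronglyMeasurable, integral_pi_norm_cexp,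
        ENNReal.toReal_ofReal (by positivity), smul_eq_mul]
      ring
  refine ⟨hint, ?_⟩
  have h1 := hasSum_integral_measure hint
  have h2 : HasSum (fun n : ℕ => Complex.exp (-(ν.real univ : ℂ)) *
      ((∫ x, Complex.exp (-(q * x)) ∂ν) ^ n / n.factorial))
      (Complex.exp (-(ν.real univ : ℂ)) * Complex.exp (∫ x, Complex.exp (-(q * x)) ∂ν)) := by
    have := NormedSpace.expSeries_div_hasSum_exp (∫ x, Complex.exp (-(q * x)) ∂ν)
    rw [← Complex.exp_eq_exp_ℂ] at this
    exact this.mul_left _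
  have h3 := h1.unique (h2.congr_fun fun n => by
    rw [integral_smul_measure, integral_map (hm n).aemeasurable
        (measurable_cexp_neg_mul q).aestronglyMeasurable, integral_pi_cexp,
        ENNReal.toReal_ofReal (by positivity), Complex.real_smul]
    push_cast
    ring)
  refine h3.trans ?_
  rw [← Complex.exp_add, integral_sub hq (integrable_const _), integral_const]
  simp
  ring_nf

end

/-! ### Frullani's integral, gamma laws and Lévy densities -/

/-- Frullani's integral. -/
theorem integral_frullani {θ : ℝ} (hθ : 0 < θ) {q : ℂ} (hq : -θ < q.re) :
    IntegrableOn (fun t : ℝ => (Complex.exp (-((q + θ) * t)) - Complex.exp (-(θ * t))) / t)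
      (Ioi 0) ∧
    ∫ t in Ioi (0 : ℝ), (Complex.exp (-((q + θ) * t)) - Complex.exp (-(θ * t))) / t =
      Complex.log θ - Complex.log (q + θ) := by
  -- The case M = N = 0, where F = 1 and L_0 = -log.
  have h := barnesS_barnesLogGamma_sub (a := Fin.elim0) (b := Fin.elim0) le_rfl
    (fun j => j.elim0) (fun j => j.elim0) (b₀ := θ) (q := q) (q' := 0) hq (by simpa using hθ)
  simp only [barnesS_eq_sum_powerset, expProdQuot, Finset.univ_eq_empty, Finset.powerset_empty,
    Finset.sum_singleton, Finset.card_empty, pow_zero, Finset.sum_empty, Finset.prod_empty,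
    add_zero, zero_add, one_mul, mul_one, Complex.ofReal_one] at h
  refine ⟨h.1, ?_⟩
  rw [← h.2, barnesLogGamma_zero_params _ (by simp; linarith),
    barnesLogGamma_zero_params _ (by simpa using hθ)]
  ring

theorem gammaMeasure_laplace {c θ : ℝ} (hc : 0 < c) (hθ : 0 < θ) {q : ℂ} (hq : -θ < q.re) :
    Integrable (fun x : ℝ => Complex.exp (-(q * x))) (ProbabilityTheory.gammaMeasure c θ) ∧
    ∫ x : ℝ, Complex.exp (-(q * x)) ∂(ProbabilityTheory.gammaMeasure c θ) =
      Complex.exp (c * (Complex.log θ - Complex.log (q + θ))) := by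
  have hm : Measurable (ProbabilityTheory.gammaPDF c θ) :=
    (ProbabilityTheory.measurable_gammaPDFReal c θ).ennreal_ofReal
  have hlt : ∀ᵐ x ∂(volume : Measure ℝ), ProbabilityTheory.gammaPDF c θ x < ⊤ :=
    Eventually.of_forall fun x => ENNReal.ofReal_lt_top
  have hre : 0 < (q + θ).re := by simp; linarith
  have hne : q + θ ≠ 0 := fun h => by simp [h] at hre
  have hzero : ∀ x ∉ Ici (0 : ℝ), (ProbabilityTheory.gammaPDF c θ x).toReal •
      Complex.exp (-(q * x)) = 0 := fun x hx => by
    rw [ProbabilityTheory.gammaPDF_of_neg (not_le.1 hx)]; simp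
  have heq : ∀ x ∈ Ioi (0 : ℝ), (ProbabilityTheory.gammaPDF c θ x).toReal •
      Complex.exp (-(q * x)) = ((θ ^ c / Real.Gamma c : ℝ) : ℂ) *
        ((x : ℂ) ^ ((c : ℂ) - 1) * Complex.exp (-((q + θ) * x))) := fun x hx => by
    have hx0 : (0 : ℝ) < x := hx
    have hG := Real.Gamma_pos_of_pos hc
    rw [ProbabilityTheory.gammaPDF_of_nonneg hx0.le, ENNReal.toReal_ofReal (by positivity),
      Complex.real_smul, Complex.ofReal_mul, Complex.ofReal_mul, Complex.ofReal_cpow hx0.le,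
      mul_assoc, mul_assoc, Complex.ofReal_exp, ← Complex.exp_add]
    push_cast
    ring_nf
  have hint := (integrableOn_cpow_mul_cexp_neg_mul (s := c) (by simpa using hc) hre).const_mul
    ((θ ^ c / Real.Gamma c : ℝ) : ℂ)
  rw [ProbabilityTheory.gammaMeasure, integrable_withDensity_iff_integrable_smul' hm hlt,
    integral_withDensity_eq_integral_toReal_smul hm hlt]
  constructor
  · rw [← integrableOn_iff_integrable_of_support_subset (s := Ici 0)
      (fun x hx => by by_contra h; exact hx (hzero x h)), integrableOn_Ici_iff_integrableOn_Ioi]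
    exact (integrableOn_congr_fun heq measurableSet_Ioi).2 hint
  · rw [← setIntegral_eq_integral_of_forall_compl_eq_zero hzero, integral_Ici_eq_integral_Ioi,
      setIntegral_congr_fun measurableSet_Ioi heq, integral_const_mul,
      integral_cpow_mul_cexp_neg_mul_Ioi (by simpa using hc) hre]
    have hG : (Real.Gamma c : ℂ) ≠ 0 := by exact_mod_cast (Real.Gamma_pos_of_pos hc).ne'
    have harg : (q + θ).arg ≠ Real.pi := by
      have h2 := (abs_lt.1 (Complex.abs_arg_lt_pi_div_two_iff.2 (Or.inl hre))).2
      linarith [Real.pi_pos]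
    rw [Complex.Gamma_ofReal, Complex.cpow_def_of_ne_zero (one_div_ne_zero hne), one_div,
      Complex.log_inv _ harg, Complex.ofReal_div, Complex.ofReal_cpow hθ.le,
      Complex.cpow_def_of_ne_zero (by exact_mod_cast hθ.ne'), mul_sub, Complex.exp_sub,
      neg_mul, Complex.exp_neg, mul_comm (c : ℂ) (Complex.log θ), mul_comm (c : ℂ)]
    field_simp

theorem exists_measure_laplace_frullani {c θ : ℝ} (hc : 0 ≤ c) (hθ : 0 < θ) :
    ∃ P : Measure ℝ, IsProbabilityMeasure P ∧ (∀ᵐ x ∂P, 0 ≤ x) ∧ ∀ q : ℂ, -θ < q.re →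
      Integrable (fun x : ℝ => Complex.exp (-(q * x))) P ∧
      ∫ x : ℝ, Complex.exp (-(q * x)) ∂P =
        Complex.exp (c * (Complex.log θ - Complex.log (q + θ))) := by
  rcases hc.eq_or_lt with rfl | hc
  -- A gamma law needs positive shape; for c = 0 its role is taken by the point mass at 0.
  · refine ⟨Measure.dirac 0, inferInstance, ?_, fun q _ => ⟨integrable_dirac (by simp), ?_⟩⟩
    · rw [ae_dirac_iff measurableSet_Ici]
    · simp
  · refine ⟨_, ProbabilityTheory.isProbabilityMeasure_gammaMeasure hc hθ, ?_,
      fun q hq => gammaMeasure_laplace hc hθ hq⟩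
    have hm : Measurable (ProbabilityTheory.gammaPDF c θ) :=
      (ProbabilityTheory.measurable_gammaPDFReal c θ).ennreal_ofReal
    rw [ProbabilityTheory.gammaMeasure, ae_withDensity_iff hm]
    refine Eventually.of_forall fun x hx => ?_
    by_contra h
    exact hx (ProbabilityTheory.gammaPDF_of_neg (not_le.1 h))

/-- Existence of the infinitely divisible distribution on `[0, ∞)` with Lévy density `g(t) / t`,
where `g` differs from an exponential by a function vanishing at `0`. -/
theorem exists_measure_laplace_levy {b₀ θ c C : ℝ} {g : ℝ → ℝ} (hb₀ : 0 < b₀) (hθ : b₀ ≤ θ)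
    (hc : 0 ≤ c) (hg : Measurable g)
    (hnonneg : ∀ t, 0 < t → 0 ≤ (g t - c * Real.exp (-(θ * t))) / t)
    (hle : ∀ t, 0 < t → (g t - c * Real.exp (-(θ * t))) / t ≤ C * Real.exp (-(b₀ * t))) :
    ∃ P : Measure ℝ, IsProbabilityMeasure P ∧ (∀ᵐ x ∂P, 0 ≤ x) ∧ ∀ q : ℂ, -b₀ < q.re →
      Integrable (fun x : ℝ => Complex.exp (-(q * x))) P ∧
      ∫ x : ℝ, Complex.exp (-(q * x)) ∂P =
        Complex.exp (∫ t in Ioi (0 : ℝ), (Complex.exp (-(q * t)) - 1) * (g t : ℂ) / t) := by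
  set d : ℝ → ℝ := fun t => (g t - c * Real.exp (-(θ * t))) / t with hd
  have hdm : Measurable d := by fun_prop
  have hdm' : Measurable fun t => ENNReal.ofReal (d t) := hdm.ennreal_ofReal
  have hdlt : ∀ᵐ t ∂(volume.restrict (Ioi (0 : ℝ))), ENNReal.ofReal (d t) < ⊤ :=
    Eventually.of_forall fun t => ENNReal.ofReal_lt_top
  have hdint : ∀ q : ℂ, -b₀ < q.re →
      IntegrableOn (fun t : ℝ => (d t : ℂ) * Complex.exp (-(q * t))) (Ioi 0) := by
    intro q hq
    have h := (exp_neg_integrableOn_Ioi 0 (by linarith : 0 < b₀ + q.re)).const_mul C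
    refine h.mono' (by fun_prop) ?_
    filter_upwards [ae_restrict_mem measurableSet_Ioi] with t ht
    rw [norm_mul, norm_cexp_neg_mul_ofReal, Complex.norm_real,
      Real.norm_of_nonneg (hnonneg t ht)]
    refine (mul_le_mul_of_nonneg_right (hle t ht) (Real.exp_pos _).le).trans (le_of_eq ?_)
    rw [mul_assoc, ← Real.exp_add]
    ring_nf
  have hdint0 : IntegrableOn d (Ioi 0) := by
    have := (hdint 0 (by simpa using hb₀)).re
    simpa [IntegrableOn] using this
  -- The Lévy measure left after the gamma part c e^(-θt) / t is removed. It is finite and serves as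
  -- jump measure; the required law is the convolution of the gamma and compound Poisson laws.
  let ν : Measure ℝ := (volume.restrict (Ioi (0 : ℝ))).withDensity fun t => ENNReal.ofReal (d t)
  have hνfin : IsFiniteMeasure ν := isFiniteMeasure_withDensity_ofReal hdint0.2
  have hν0 : ∀ᵐ x ∂ν, 0 ≤ x := by
    refine (withDensity_absolutelyContinuous _ _).ae_le ?_
    filter_upwards [ae_restrict_mem measurableSet_Ioi] with t ht using le_of_lt ht
  have hνint : ∀ q : ℂ, -b₀ < q.re → Integrable (fun x : ℝ => Complex.exp (-(q * x))) ν := by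
    intro q hq
    rw [integrable_withDensity_iff_integrable_smul' hdm' hdlt]
    refine (integrableOn_congr_fun (fun t ht => ?_) measurableSet_Ioi).1 (hdint q hq)
    rw [ENNReal.toReal_ofReal (hnonneg t ht), Complex.real_smul]
  obtain ⟨γ, hγ, hγ0, hγL⟩ := exists_measure_laplace_frullani hc (hb₀.trans_le hθ)
  have hCP := isProbabilityMeasure_compoundPoisson ν
  refine ⟨(γ.prod (compoundPoisson ν)).map fun z => z.1 + z.2,
    Measure.isProbabilityMeasure_map (by fun_prop), ?_, fun q hq => ?_⟩
  · rw [ae_map_iff (by fun_prop) measurableSet_Ici]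
    filter_upwards [Measure.quasiMeasurePreserving_fst.ae hγ0,
      Measure.quasiMeasurePreserving_snd.ae (ae_nonneg_compoundPoisson ν hν0)] with z h1 h2
    exact add_nonneg h1 h2
  · have hL1 := hγL q (by linarith)
    have hL2 := compoundPoisson_laplace ν (hνint q hq)
    have hmul : (fun z : ℝ × ℝ => Complex.exp (-(q * ((z.1 + z.2 : ℝ) : ℂ)))) =
        fun z => Complex.exp (-(q * z.1)) * Complex.exp (-(q * z.2)) := by
      funext z
      rw [← Complex.exp_add]
      push_cast
      ring_nf
    rw [integrable_map_measure (measurable_cexp_neg_mul q).aestronglyMeasurable (by fun_prop),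
      integral_map (by fun_prop) (measurable_cexp_neg_mul q).aestronglyMeasurable]
    refine ⟨?_, ?_⟩
    · change Integrable (fun z : ℝ × ℝ => Complex.exp (-(q * ((z.1 + z.2 : ℝ) : ℂ)))) _
      rw [hmul]
      exact hL1.1.mul_prod hL2.1
    · rw [hmul, integral_prod_mul (fun x : ℝ => Complex.exp (-(q * x)))
        (fun x : ℝ => Complex.exp (-(q * x))), hL1.2, hL2.2, ← Complex.exp_add]
      congr 1
      -- The two exponents recombine: (e^(-qt) - 1) times c e^(-θt)/t + d(t) is (e^(-qt) - 1)
      -- g(t)/t.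
      have hF := integral_frullani (hb₀.trans_le hθ) (q := q) (by linarith)
      rw [← hF.2, integral_withDensity_eq_integral_toReal_smul hdm' hdlt, ← integral_const_mul,
        ← integral_add (hF.1.const_mul _)]
      · refine setIntegral_congr_fun measurableSet_Ioi fun t ht => ?_
        have ht0 : (t : ℂ) ≠ 0 := by exact_mod_cast (ne_of_gt ht)
        have h1 : Complex.exp (-((q + θ) * t)) =
            Complex.exp (-(q * t)) * Complex.exp (-(θ * t)) := by
          rw [← Complex.exp_add]; ring_nf
        rw [ENNReal.toReal_ofReal (hnonneg t ht), Complex.real_smul, h1]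
        push_cast [hd]
        field_simp
        ring
      · rw [← integrable_withDensity_iff_integrable_smul' hdm' hdlt]
        exact (hνint q hq).sub (integrable_const _)

/-! ### Existence and uniqueness of the Barnes beta distribution -/

section

variable {M N : ℕ} {a : Fin M → ℝ} {b : Fin N → ℝ}

/-- The gamma rate b₀ + ∑ b_j is the one for which F ≥ K e^(-(∑ b_j) t) makes the remainder
nonnegative when M = N. For t ≤ 1 the remainder in F is O(t), which pays for the division by t; for
t ≥ 1 boundedness of F is enough. -/
theorem exists_levy_bounds (hMN : M ≤ N) (ha : ∀ j, 0 < a j) (hb : ∀ j, 0 < b j) (b₀ : ℝ) :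
    ∃ c C : ℝ, 0 ≤ c ∧ ∀ t, 0 < t →
      0 ≤ (Real.exp (-(b₀ * t)) * expProdQuot a b t -
        c * Real.exp (-((b₀ + ∑ j, b j) * t))) / t ∧
      (Real.exp (-(b₀ * t)) * expProdQuot a b t -
        c * Real.exp (-((b₀ + ∑ j, b j) * t))) / t ≤ C * Real.exp (-(b₀ * t)) := by
  set K : ℝ := (∏ j, b j) * (∏ j, (a j)⁻¹) with hK
  have hKpos : 0 < K := mul_pos (Finset.prod_pos fun j _ => hb j)
    (Finset.prod_pos fun j _ => inv_pos.2 (ha j))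
  set A := ∑ j, a j
  set B := ∑ j, b j
  have hA : 0 ≤ A := Finset.sum_nonneg fun j _ => (ha j).le
  have hB : 0 ≤ B := Finset.sum_nonneg fun j _ => (hb j).le
  have hexp : ∀ t, Real.exp (-((b₀ + B) * t)) = Real.exp (-(b₀ * t)) * Real.exp (-(B * t)) :=
    fun t => by rw [← Real.exp_add]; ring_nf
  suffices h : ∃ c C : ℝ, 0 ≤ c ∧ ∀ t, 0 < t → c * Real.exp (-(B * t)) ≤ expProdQuot a b t ∧
      (t ≤ 1 → expProdQuot a b t - c * Real.exp (-(B * t)) ≤ C * t) by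
    obtain ⟨c, C, hc, h⟩ := h
    set D := ∏ j, (1 - Real.exp (-(a j)))⁻¹
    refine ⟨c, max C D, hc, fun t ht => ?_⟩
    have hfac : (Real.exp (-(b₀ * t)) * expProdQuot a b t -
        c * Real.exp (-((b₀ + B) * t))) / t =
        (expProdQuot a b t - c * Real.exp (-(B * t))) / t * Real.exp (-(b₀ * t)) := by
      rw [hexp]; ring
    rw [hfac]
    refine ⟨mul_nonneg (div_nonneg (sub_nonneg.2 (h t ht).1) ht.le) (Real.exp_pos _).le,
      mul_le_mul_of_nonneg_right ?_ (Real.exp_pos _).le⟩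
    rw [div_le_iff₀ ht]
    rcases le_total t 1 with h1 | h1
    · exact ((h t ht).2 h1).trans (mul_le_mul_of_nonneg_right (le_max_left _ _) ht.le)
    · have h2 : expProdQuot a b t ≤ D := expProdQuot_le_of_one_le ha hb h1
      have h3 : 0 ≤ c * Real.exp (-(B * t)) := by positivity
      have h4 : 0 ≤ D := (expProdQuot_pos ha hb ht).le.trans h2
      calc expProdQuot a b t - c * Real.exp (-(B * t)) ≤ D := by linarith
        _ ≤ D * t := le_mul_of_one_le_right h4 h1
        _ ≤ max C D * t := mul_le_mul_of_nonneg_right (le_max_right _ _) ht.le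
  -- For M = N the gamma shape is the limit K of F at 0; for M < N no gamma part is needed and c =
  -- 0.
  rcases hMN.eq_or_lt with h | h
  · refine ⟨K, K * Real.exp A * (A + B), hKpos.le, fun t ht => ⟨?_, fun ht1 => ?_⟩⟩
    · have := le_expProdQuot hMN ha hb ht
      rwa [show N - M = 0 by omega, pow_zero, mul_one] at this
    · have h1 := expProdQuot_le hMN ha hb ht
      rw [show N - M = 0 by omega, pow_zero, mul_one] at h1
      have h2 := one_sub_exp_neg_le ((A + B) * t)
      have h3 : Real.exp (-(B * t)) = Real.exp (A * t) * Real.exp (-((A + B) * t)) := by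
        rw [← Real.exp_add]; ring_nf
      have h4 : Real.exp (A * t) ≤ Real.exp A := Real.exp_le_exp.2 (by nlinarith)
      calc expProdQuot a b t - K * Real.exp (-(B * t))
          ≤ K * Real.exp (A * t) - K * Real.exp (-(B * t)) := by gcongr
        _ = K * Real.exp (A * t) * (1 - Real.exp (-((A + B) * t))) := by rw [h3]; ring
        _ ≤ K * Real.exp (A * t) * ((A + B) * t) := by gcongr
        _ ≤ K * Real.exp A * ((A + B) * t) := by gcongr
        _ = K * Real.exp A * (A + B) * t := by ring
  · refine ⟨0, K * Real.exp A, le_rfl, fun t ht => ⟨?_, fun ht1 => ?_⟩⟩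
    · simpa using (expProdQuot_pos ha hb ht).le
    · have h1 := expProdQuot_le hMN ha hb ht
      have h2 : t ^ (N - M) ≤ t := pow_le_of_le_one ht.le ht1 (by omega)
      have h4 : Real.exp (A * t) ≤ Real.exp A := Real.exp_le_exp.2 (by nlinarith)
      calc expProdQuot a b t - 0 * Real.exp (-(B * t)) = expProdQuot a b t := by ring
        _ ≤ K * t ^ (N - M) * Real.exp (A * t) := h1
        _ ≤ K * t * Real.exp A := by gcongr
        _ = K * Real.exp A * t := by ring

theorem cpow_ofReal_exp_neg (x : ℝ) (q : ℂ) :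
    ((Real.exp (-x) : ℝ) : ℂ) ^ q = Complex.exp (-(q * x)) := by
  rw [Complex.cpow_def_of_ne_zero (by exact_mod_cast (Real.exp_pos _).ne'), ← Complex.ofReal_log
    (Real.exp_pos _).le, Real.log_exp]
  push_cast
  ring_nf

theorem measurable_ofReal_cpow (q : ℂ) : Measurable fun x : ℝ => (x : ℂ) ^ q :=
  Complex.measurable_ofReal.pow_const q

/-- The distribution is the image under x ↦ e^(-x) of the infinitely divisible law with Lévy density
e^(-b₀ t) F(t) / t; Laplace transforms become Mellin transforms. -/
theorem exists_isBarnesBeta (hMN : M ≤ N) (ha : ∀ j, 0 < a j) {b₀ : ℝ} (hb₀ : 0 < b₀)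
    (hb : ∀ j, 0 < b j) : ∃ μ, IsBarnesBeta a b₀ b μ := by
  obtain ⟨c, C, hc, h⟩ := exists_levy_bounds hMN ha hb b₀
  have hB : 0 ≤ ∑ j, b j := Finset.sum_nonneg fun j _ => (hb j).le
  have hmeas : Measurable fun t => Real.exp (-(b₀ * t)) * expProdQuot a b t := by
    unfold expProdQuot; fun_prop
  obtain ⟨P, hP, hP0, hL⟩ := exists_measure_laplace_levy hb₀ (by linarith) hc hmeas
    (fun t ht => (h t ht).1) (fun t ht => (h t ht).2)
  have hm : Measurable fun x : ℝ => Real.exp (-x) := by fun_prop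
  refine ⟨P.map fun x => Real.exp (-x), Measure.isProbabilityMeasure_map hm.aemeasurable, ?_,
    fun q hq => ?_, fun q hq => ?_⟩
  · refine (ae_map_iff hm.aemeasurable measurableSet_Ioc).2 ?_
    filter_upwards [hP0] with x hx
    exact ⟨Real.exp_pos _, Real.exp_le_one_iff.2 (by linarith)⟩
  · rw [integrable_map_measure (measurable_ofReal_cpow q).aestronglyMeasurable hm.aemeasurable]
    exact (hL q hq).1.congr (Eventually.of_forall fun x => (cpow_ofReal_exp_neg x q).symm)
  · rw [integral_map hm.aemeasurable (measurable_ofReal_cpow q).aestronglyMeasurable]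
    simp_rw [cpow_ofReal_exp_neg]
    rw [(hL q hq).2, barnesEta,
      (barnesS_barnesLogGamma_sub hMN ha hb hq (by simpa using hb₀)).2]
    congr 1
    refine setIntegral_congr_fun measurableSet_Ioi fun t ht => ?_
    have h1 : Complex.exp (-((q + b₀) * t)) =
        Complex.exp (-(q * t)) * Complex.exp (-(b₀ * t)) := by
      rw [← Complex.exp_add]; ring_nf
    rw [h1, zero_add]
    push_cast
    ring

/-- At q = it, admissible because b₀ > 0, the Mellin transform is the characteristic function of log
x. On (0, 1] the logarithm is inverted by the exponential, so the law itself is recovered. -/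
theorem IsBarnesBeta.eq {b₀ : ℝ} (hb₀ : 0 < b₀) {μ μ' : Measure ℝ} (h : IsBarnesBeta a b₀ b μ)
    (h' : IsBarnesBeta a b₀ b μ') : μ = μ' := by
  have hchar : ∀ ρ : Measure ℝ, IsBarnesBeta a b₀ b ρ → ∀ t : ℝ,
      charFun (ρ.map Real.log) t = barnesEta a b₀ b (t * Complex.I) := by
    intro ρ hρ t
    rw [charFun_apply_real, integral_map Real.measurable_log.aemeasurable (by fun_prop),
      ← hρ.mellin _ (by simpa using hb₀)]
    refine integral_congr_ae ?_
    filter_upwards [hρ.ae_mem] with x hx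
    rw [Complex.cpow_def_of_ne_zero (by exact_mod_cast hx.1.ne'), ← Complex.ofReal_log hx.1.le]
    ring_nf
  have hback : ∀ ρ : Measure ℝ, IsBarnesBeta a b₀ b ρ → (ρ.map Real.log).map Real.exp = ρ := by
    intro ρ hρ
    rw [Measure.map_map Real.measurable_exp Real.measurable_log]
    refine (Measure.map_congr (g := id) ?_).trans Measure.map_id
    filter_upwards [hρ.ae_mem] with x hx
    exact Real.exp_log hx.1
  have := h.isProbabilityMeasure
  have := h'.isProbabilityMeasure
  have := Measure.isProbabilityMeasure_map (μ := μ) Real.measurable_log.aemeasurable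
  have := Measure.isProbabilityMeasure_map (μ := μ') Real.measurable_log.aemeasurable
  rw [← hback μ h, ← hback μ' h', Measure.ext_of_charFun (μ := μ.map Real.log)
    (ν := μ'.map Real.log) (funext fun t => (hchar μ h t).trans (hchar μ' h' t).symm)]

theorem IsBarnesBeta.integrable_rpow {b₀ : ℝ} {μ : Measure ℝ} (h : IsBarnesBeta a b₀ b μ) {r : ℝ}
    (hr : -b₀ < r) : Integrable (fun x : ℝ => x ^ r) μ := by
  refine (h.integrable r (by simpa using hr)).re.congr ?_
  filter_upwards [h.ae_mem] with x hx
  rw [← Complex.ofReal_cpow hx.1.le]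
  exact Complex.ofReal_re _

theorem IsBarnesBeta.integral_rpow {b₀ : ℝ} {μ : Measure ℝ} (h : IsBarnesBeta a b₀ b μ) {r : ℝ}
    (hr : -b₀ < r) : ((∫ x : ℝ, x ^ r ∂μ : ℝ) : ℂ) = barnesEta a b₀ b r := by
  rw [← h.mellin r (by simpa using hr), ← integral_complex_ofReal]
  refine integral_congr_ae ?_
  filter_upwards [h.ae_mem] with x hx
  rw [← Complex.ofReal_cpow hx.1.le]

end

/-! ### Functional equation and moments -/

section

variable {m N : ℕ} {a : Fin (m + 1) → ℝ} {b : Fin N → ℝ}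

/-- The functional equation of `S_N L_M` under translation by one of the parameters. -/
theorem barnesS_barnesLogGamma_add (hMN : m + 1 ≤ N) (ha : ∀ j, 0 < a j) (hb : ∀ j, 0 < b j)
    {b₀ : ℝ} (i : Fin (m + 1)) {q : ℂ} (hq : -b₀ < q.re) :
    barnesS (barnesLogGamma a) (q + a i) b₀ b =
      barnesS (barnesLogGamma a) q b₀ b -
        barnesS (barnesLogGamma (i.removeNth a)) q b₀ b := by
  have hq' : -b₀ < (q + a i).re := by
    have := ha i
    simp only [Complex.add_re, Complex.ofReal_re]
    linarith
  have h1 := (barnesS_barnesLogGamma_sub hMN ha hb hq' hq).2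
  have h2 := barnesS_barnesLogGamma (a := i.removeNth a) hMN
    (fun j => ha (i.succAbove j)) hb hq
  suffices h : barnesS (barnesLogGamma a) (q + a i) b₀ b - barnesS (barnesLogGamma a) q b₀ b =
      -barnesS (barnesLogGamma (i.removeNth a)) q b₀ b by
    linear_combination h
  rw [h1, h2, ← integral_neg]
  refine setIntegral_congr_fun measurableSet_Ioi fun t ht => ?_
  have hpos := (one_sub_exp_neg_pos (ha i) ht).ne'
  -- Deleting a_i costs the factor 1 - e^(-a_i t), which is minus the factor produced by the shift.
  -- With one parameter fewer than M ≤ N, the unsubtracted integral formula applies.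
  have hF : expProdQuot (i.removeNth a) b t =
      expProdQuot a b t * (1 - Real.exp (-(a i * t))) := by
    simp only [expProdQuot]
    rw [Fin.prod_univ_succAbove (fun j => (1 - Real.exp (-(a j * t)))⁻¹) i]
    simp only [Fin.removeNth_apply]
    linear_combination -((∏ j, (1 - Real.exp (-(b j * t)))) *
      ∏ j, (1 - Real.exp (-(a (i.succAbove j) * t)))⁻¹) * inv_mul_cancel₀ hpos
  have hE : Complex.exp (-((q + a i + b₀) * t)) =
      Complex.exp (-((q + b₀) * t)) * Complex.exp (-(a i * t)) := by
    rw [← Complex.exp_add]; ring_nf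
  rw [hF, hE]
  push_cast
  ring

theorem barnesEta_nat_mul (hMN : m + 1 ≤ N) (ha : ∀ j, 0 < a j) (hb : ∀ j, 0 < b j)
    {b₀ : ℝ} (hb₀ : 0 < b₀) (i : Fin (m + 1)) (k : ℕ) :
    barnesEta a b₀ b ((k : ℂ) * (a i : ℂ)) = Complex.exp (-∑ l ∈ Finset.range k,
      barnesS (barnesLogGamma (i.removeNth a)) ((l : ℂ) * (a i : ℂ)) b₀ b) := by
  rw [barnesEta]
  congr 1
  induction k with
  | zero => simp
  | succ k ih =>
    have hq : -b₀ < ((k : ℂ) * (a i : ℂ)).re := by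
      have := mul_nonneg (Nat.cast_nonneg (α := ℝ) k) (ha i).le
      simp only [Complex.re_mul_ofReal, Complex.natCast_re]
      linarith
    have h := barnesS_barnesLogGamma_add hMN ha hb i hq
    rw [Finset.sum_range_succ, show ((k + 1 : ℕ) : ℂ) * (a i : ℂ) = (k : ℂ) * a i + a i by
      push_cast; ring]
    linear_combination h + ih

/-- The functional equation is used backwards, at the points -(l+1) a_i with l < k. All of them lie
to the right of -b₀ because k a_i < b₀. -/
theorem barnesEta_neg_nat_mul (hMN : m + 1 ≤ N) (ha : ∀ j, 0 < a j) (hb : ∀ j, 0 < b j)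
    {b₀ : ℝ} (i : Fin (m + 1)) (k : ℕ) (hk : (k : ℝ) * a i < b₀) :
    barnesEta a b₀ b (-((k : ℂ) * (a i : ℂ))) = Complex.exp (∑ l ∈ Finset.range k,
      barnesS (barnesLogGamma (i.removeNth a)) (-((l : ℂ) + 1) * (a i : ℂ)) b₀ b) := by
  rw [barnesEta]
  congr 1
  induction k with
  | zero => simp
  | succ k ih =>
    push_cast at hk
    have hq : -b₀ < (-((k : ℂ) + 1) * (a i : ℂ)).re := by
      simp only [Complex.re_mul_ofReal, Complex.neg_re, Complex.add_re, Complex.natCast_re,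
        Complex.one_re]
      linarith
    have h := barnesS_barnesLogGamma_add hMN ha hb i hq
    rw [show -((k : ℂ) + 1) * (a i : ℂ) + a i = -((k : ℂ) * a i) by ring] at h
    have ih' := ih (by have := ha i; linarith)
    rw [Finset.sum_range_succ, show -(((k + 1 : ℕ) : ℂ) * (a i : ℂ)) = -((k : ℂ) + 1) * a i by
      push_cast; ring]
    linear_combination ih' - h

end

/-- The exponents ±1 are integers, so they pass through the exponential without any choice of
branch. -/
theorem prod_barnesGamma_zpow {n N : ℕ} (c : Fin n → ℝ) (q : ℂ) (b₀ : ℝ) (b : Fin N → ℝ) :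
    ∏ p ∈ Finset.range (N + 1),
      (∏ J ∈ Finset.powersetCard p (Finset.univ : Finset (Fin N)),
        barnesGamma c (q + b₀ + ∑ j ∈ J, (b j : ℂ))) ^ ((-1 : ℤ) ^ p) =
      Complex.exp (barnesS (barnesLogGamma c) q b₀ b) := by
  rw [barnesS, Complex.exp_sum]
  refine Finset.prod_congr rfl fun p _ => ?_
  simp only [barnesGamma]
  rw [← Complex.exp_sum, ← Complex.exp_int_mul]
  push_cast
  rfl

theorem prod_barnesGamma_zpow_succ {n N : ℕ} (c : Fin n → ℝ) (q : ℂ) (b₀ : ℝ) (b : Fin N → ℝ) :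
    ∏ p ∈ Finset.range (N + 1),
      (∏ J ∈ Finset.powersetCard p (Finset.univ : Finset (Fin N)),
        barnesGamma c (q + b₀ + ∑ j ∈ J, (b j : ℂ))) ^ ((-1 : ℤ) ^ (p + 1)) =
      Complex.exp (-barnesS (barnesLogGamma c) q b₀ b) := by
  rw [Complex.exp_neg, ← prod_barnesGamma_zpow, ← Finset.prod_inv_distrib]
  refine Finset.prod_congr rfl fun p _ => ?_
  rw [pow_succ, mul_neg_one, zpow_neg]

/-- Here the number of parameters `a` is `M = m + 1 ≥ 1`, and `i.removeNth a` is the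
tuple `a` with its `i`-th entry deleted. -/
theorem mainTheorem7 {m N : ℕ} (hMN : m + 1 ≤ N)
    (a : Fin (m + 1) → ℝ) (ha : ∀ j, 0 < a j)
    (b₀ : ℝ) (hb₀ : 0 < b₀) (b : Fin N → ℝ) (hb : ∀ j, 0 < b j)
    (i : Fin (m + 1)) :
    (∃! μ : MeasureTheory.Measure ℝ, IsBarnesBeta a b₀ b μ) ∧
    ∀ μ : MeasureTheory.Measure ℝ, IsBarnesBeta a b₀ b μ →
      -- positive moments
      (∀ k : ℕ,
        MeasureTheory.Integrable (fun x : ℝ => x ^ ((k : ℝ) * a i)) μ ∧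
        ((∫ x : ℝ, x ^ ((k : ℝ) * a i) ∂μ : ℝ) : ℂ) =
          Complex.exp (-∑ l ∈ Finset.range k,
            barnesS (barnesLogGamma (i.removeNth a)) ((l : ℂ) * (a i : ℂ)) b₀ b) ∧
        ((∫ x : ℝ, x ^ ((k : ℝ) * a i) ∂μ : ℝ) : ℂ) =
          ∏ l ∈ Finset.range k, ∏ p ∈ Finset.range (N + 1),
            (∏ J ∈ Finset.powersetCard p (Finset.univ : Finset (Fin N)),
              barnesGamma (i.removeNth a)
                ((l : ℂ) * (a i : ℂ) + b₀ + ∑ j ∈ J, (b j : ℂ))) ^ ((-1 : ℤ) ^ (p + 1))) ∧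
      -- negative moments
      (∀ k : ℕ, (k : ℝ) * a i < b₀ →
        MeasureTheory.Integrable (fun x : ℝ => x ^ (-((k : ℝ) * a i))) μ ∧
        ((∫ x : ℝ, x ^ (-((k : ℝ) * a i)) ∂μ : ℝ) : ℂ) =
          Complex.exp (∑ l ∈ Finset.range k,
            barnesS (barnesLogGamma (i.removeNth a)) (-((l : ℂ) + 1) * (a i : ℂ)) b₀ b) ∧
        ((∫ x : ℝ, x ^ (-((k : ℝ) * a i)) ∂μ : ℝ) : ℂ) =
          ∏ l ∈ Finset.range k, ∏ p ∈ Finset.range (N + 1),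
            (∏ J ∈ Finset.powersetCard p (Finset.univ : Finset (Fin N)),
              barnesGamma (i.removeNth a)
                (-((l : ℂ) + 1) * (a i : ℂ) + b₀ + ∑ j ∈ J, (b j : ℂ))) ^ ((-1 : ℤ) ^ p)) := by
  refine ⟨?_, fun μ hμ => ⟨fun k => ?_, fun k hk => ?_⟩⟩
  · obtain ⟨μ, hμ⟩ := exists_isBarnesBeta hMN ha hb₀ hb
    exact ⟨μ, hμ, fun μ' hμ' => hμ'.eq hb₀ hμ⟩
  · have hr : -b₀ < (k : ℝ) * a i := by
      have := mul_nonneg (Nat.cast_nonneg (α := ℝ) k) (ha i).le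
      linarith
    have h := hμ.integral_rpow hr
    push_cast at h
    rw [barnesEta_nat_mul hMN ha hb hb₀] at h
    refine ⟨hμ.integrable_rpow hr, h, h.trans ?_⟩
    rw [← Finset.sum_neg_distrib, Complex.exp_sum]
    exact Finset.prod_congr rfl fun l _ => (prod_barnesGamma_zpow_succ _ _ _ _).symm
  · have hr : -b₀ < -((k : ℝ) * a i) := by linarith
    have h := hμ.integral_rpow hr
    push_cast at h
    rw [barnesEta_neg_nat_mul hMN ha hb i k hk] at h
    refine ⟨hμ.integrable_rpow hr, h, h.trans ?_⟩
    rw [Complex.exp_sum]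
    exact Finset.prod_congr rfl fun l _ => (prod_barnesGamma_zpow _ _ _ _).symm
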